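/- **Corollary 3.4.** *Setting.* For a finite simple undirected graph $H=(V,E_H)$, a vertex $v$ and $h\ge 0$, let $B_h(v)$ (resp. $L_h(v)$) be the set of vertices at distance at most (resp. exactly) $h$ from $v$, and let $J(A,B)=|A\cap B|/|A\cup B|$. The algorithm Lazy-Alg$(\varphi,k)$ with $k=0$ processes a sequence of edge insertions, starting here from the graph on $V$ without edges. It stores for every $x\in V$ two sets $\tilde B_1(x),\tilde B_2(x)$, both initially $\{x\}$, and two integers $\delta_x,\Delta_x$, both initially $0$. When an edge $\{a,b\}$ is inserted, for each $x\in\{a,b\}$ in turn (in either order), with $y$ the other endpoint, it sets $\tilde B_1(x)\gets\tilde B_1(x)\cup\{y\}$, $\tilde B_2(x)\gets\tilde B_2(x)\cup\tilde B_1(y)$, $\delta_x\gets\delta_x+1$; and if then $\delta_x\ge\varphi\Delta_x$, it sets $\Delta_x\gets\Delta_x+\delta_x$, $\delta_x\gets 0$, and $\tilde B_2(z)\gets\tilde B_2(z)\cup\tilde B_1(x)$ for every current neighbour $z$ of $x$ (including $y$). *Statement.* Let $\varepsilon\in(0,1)$, $\varphi=\frac{\varepsilon}{1-\varepsilon}$,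 $\alpha>0$ and $\varepsilon'=\frac{\varphi+\alpha}{1+\varphi}$. Let $G=(V,E)$ be a finite graph whose edges are submitted to Lazy-Alg$(\varphi,0)$ in a uniformly random order. Let $0\le t\le|E|$, let $F\subseteq E$ with $|F|=t$, and condition on the event that $F$ is the set of the first $t$ edges (for $t=|E|$, $F=E$ there is no conditioning). Let $B_2$ and $L_2$ refer to the graph $(V,F)$ observed at time $t$, and let $\tilde B_2$ be the sets stored by the algorithm at time $t$. Then for any two vertices $u,v\in V$, with (conditional) probability at least $$1-e^{-\frac{2\alpha^2|L_2(u)|}{(1+\varphi)^2}}-e^{-\frac{2\alpha^2|L_2(v)|}{(1+\varphi)^2}}$$ both of the following hold: $$J(\tilde B_2(u),\tilde B_2(v))\ \ge\ (1-\varepsilon')\,J(B_2(u),B_2(v))-\varepsilon',$$ and, provided that $\varepsilon'<\tfrac12$ (so that the bound is meaningful), $$\frac{J(B_2(u),B_2(v))}{1-2\varepsilon'}\ \ge\ J(\tilde B_2(u),\tilde B_2(v)).$$ -/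

import Mathlib

/-- `ball G h v` is the set of vertices at distance at most `h` from `v` in `G`
(`edist` is the extended distance, so unreachable vertices are never counted). -/
def ball {V : Type*} (G : SimpleGraph V) (h : ℕ) (v : V) : Set V :=
  {w | G.edist v w ≤ (h : ℕ∞)}

/-- `layer G h v` is the set of vertices at distance exactly `h` from `v` in `G`. -/
def layer {V : Type*} (G : SimpleGraph V) (h : ℕ) (v : V) : Set V :=
  {w | G.edist v w = (h : ℕ∞)}

/-- Jaccard similarity `|A ∩ B| / |A ∪ B|` of two (finite) sets. -/
noncomputable def jaccard {V : Type*} (A B : Set V) : ℝ :=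
  ((A ∩ B).ncard : ℝ) / ((A ∪ B).ncard : ℝ)

/-- The memory of the lazy-update algorithm, together with the current graph. -/
structure LazyState (V : Type*) where
  /-- the current graph, which already contains the edge being inserted -/
  graph : SimpleGraph V
  /-- the maintained (exact) 1-balls -/
  apx1 : V → Set V
  /-- the maintained approximate 2-balls -/
  apx2 : V → Set V
  /-- red degrees -/
  red : V → ℕ
  /-- black degrees -/
  black : V → ℕ

namespace LazyState

/-- The initialisation on an initial graph `G₀`: exact balls, and all edges black. -/
noncomputable def init {V : Type*} (G₀ : SimpleGraph V) : LazyState V where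
  graph := G₀
  apx1 := ball G₀ 1
  apx2 := ball G₀ 2
  red := fun _ => 0
  black := fun x => (G₀.neighborSet x).ncard

/-- Add `y` to the 1-ball of `x`. -/
noncomputable def grow {V : Type*} (x y : V) (s : LazyState V) : LazyState V :=
  open Classical in
  { s with apx1 := Function.update s.apx1 x (s.apx1 x ∪ {y}) }

/-- Heavy update: merge the 1-ball of `y` into the 2-ball of `x`. -/
noncomputable def heavy {V : Type*} (x y : V) (s : LazyState V) : LazyState V :=
  open Classical in
  { s with apx2 := Function.update s.apx2 x (s.apx2 x ∪ s.apx1 y) }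

/-- Increase the red degree of `x` by one. -/
noncomputable def incRed {V : Type*} (x : V) (s : LazyState V) : LazyState V :=
  open Classical in
  { s with red := Function.update s.red x (s.red x + 1) }

/-- Batch of light updates at `x`: all edges at `x` become black, and the 1-ball of `x` is
merged into the 2-ball of every current neighbour of `x`. -/
noncomputable def batch {V : Type*} (x : V) (s : LazyState V) : LazyState V :=
  open Classical in
  { s with
    black := Function.update s.black x (s.black x + s.red x)
    red := Function.update s.red x 0
    apx2 := fun z => if s.graph.Adj x z then s.apx2 z ∪ s.apx1 x else s.apx2 z }

/-- The batch of light updates is performed exactly when the red degree of `x` has reached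
`φ` times its black degree. (For `k = 0` no randomly selected neighbour is updated otherwise.) -/
noncomputable def check {V : Type*} (φ : ℝ) (x : V) (s : LazyState V) : LazyState V :=
  open Classical in
  if φ * (s.black x : ℝ) ≤ (s.red x : ℝ) then s.batch x else s

/-- The body of the loop over the two endpoints, for the endpoint `x` of the new edge `xy`. -/
noncomputable def process {V : Type*} (φ : ℝ) (x y : V) (s : LazyState V) : LazyState V :=
  (((s.grow x y).heavy x y).incRed x).check φ x

/-- Insertion of the edge `uv` (endpoint `u` is processed first, then `v`). -/
noncomputable def insertEdge {V : Type*} (φ : ℝ) (s : LazyState V) (e : V × V) : LazyState V :=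
  process φ e.2 e.1 (process φ e.1 e.2 { s with graph := s.graph ⊔ SimpleGraph.edge e.1 e.2 })

end LazyState

/-- The lazy-update algorithm with threshold `φ` and `k = 0`, run on the initial graph `G₀`
and a sequence of edge insertions. -/
noncomputable def lazyAlg {V : Type*} (φ : ℝ) (G₀ : SimpleGraph V) (stream : List (V × V)) :
    LazyState V :=
  stream.foldl (LazyState.insertEdge φ) (LazyState.init G₀)

/-- The orderings of the edge set of `G`: the edge `σ i` is the `(i+1)`-st to be released. -/
noncomputable def EdgeOrder {V : Type*} (G : SimpleGraph V) : Type _ :=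
  Fin (Nat.card G.edgeSet) ≃ G.edgeSet

/-- Every set of orderings is an event. -/
instance {V : Type*} (G : SimpleGraph V) : MeasurableSpace (EdgeOrder G) := ⊤

/-- The uniform distribution on the orderings of the edge set of a finite graph. -/
noncomputable def uniformEdgeOrder {V : Type*} (G : SimpleGraph V) :
    MeasureTheory.Measure (EdgeOrder G) :=
  ProbabilityTheory.uniformOn Set.univ

namespace EdgeOrder

/-- The sequence of the first `t` edges. -/
noncomputable def firstEdges {V : Type*} {G : SimpleGraph V} (σ : EdgeOrder G) (t : ℕ) : List (Sym2 V) :=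
  (List.ofFn fun i => (σ.toFun i : Sym2 V)).take t

/-- The set `E⁽ᵗ⁾` of the edges released up to time `t`. -/
noncomputable def released {V : Type*} {G : SimpleGraph V} (σ : EdgeOrder G) (t : ℕ) : Set (Sym2 V) :=
  {e | e ∈ σ.firstEdges t}

/-- The approximate 2-ball of `v` at time `t`, when the algorithm starts from the graph without
edges and the edges are released in the order `σ`; `ends e` lists the two endpoints of `e` in the
order in which they are processed. -/
noncomputable def apxBall {V : Type*} {G : SimpleGraph V} (σ : EdgeOrder G) (φ : ℝ)
    (ends : Sym2 V → V × V) (t : ℕ) (v : V) : Set V :=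
  (lazyAlg φ ⊥ ((σ.firstEdges t).map ends)).apx2 v

end EdgeOrder

/-! The maintained sets only ever lose vertices, and a small relative loss in both 2-balls perturbs
the Jaccard similarity in a controlled way (`jaccard_le_and_ge`). So it suffices to bound, for each
of the two vertices, the probability that more than a fraction ε' = φ/(1+φ) + α/(1+φ) of its 2-ball
is missing (`prob_miss_le`), and to take a union bound.

If w is missing from the set of u, then w is at distance two, and for every middle vertex x the edge
xw is still red at x, that is, among the last r edges at x. The number r depends only on the degree
d of x, and r ≤ φ/(1+φ) · d. Fix one middle vertex c(w) for each w at distance two and mark the edge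
c(w)w. The misses are then at most the marked edges that are red at their middle vertex.

Given F, its order is uniform, so each marked edge is red with probability at most φ/(1+φ). However,
the stars of the neighbours of u are not independent: an edge joining two neighbours lies in two
stars. The exponential moment is therefore bounded by a potential, the product over the neighbours x
of (1 + (r/d)z)^(k+1), with k the number of marked edges at x. Revealing edges backwards in time,
the potential times the weight already collected does not increase on average (`sum_slotWeight_le`).
Marked edges lie in one star only; for an unmarked edge in two stars, ab ≤ (a² + b²)/2 splits the
effect into separate charges, and the extra exponent 1 leaves room for the squares
(`star_step_nonpos`).

The exponents add up to at most M = |L₂(u)| + deg(u) ≤ |B₂(u)|. The loss is measured against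
|B₂(u)|, so the extra exponents cost nothing, and Markov's inequality with Hoeffding's lemma gives
exp(-2a²M) with a = α/(1+φ). -/

/-! ### Elementary inequalities for a single star. -/

theorem one_add_mul_one_sub_pow_le_one (k : ℕ) {y : ℝ} (h0 : 0 ≤ y) (h1 : y ≤ 1) :
    (1 + ((k : ℝ) - 1) * y) * (1 - y) ^ k ≤ 1 := by
  have hb : 1 + (k : ℝ) * y ≤ (1 + y) ^ k := one_add_mul_le_pow (by linarith) k
  have hp : 0 ≤ (1 - y) ^ k := pow_nonneg (by linarith) k
  calc (1 + ((k : ℝ) - 1) * y) * (1 - y) ^ k ≤ (1 + y) ^ k * (1 - y) ^ k := by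
        gcongr; nlinarith
    _ = (1 - y ^ 2) ^ k := by rw [← mul_pow]; ring_nf
    _ ≤ 1 := pow_le_one₀ (by nlinarith) (by nlinarith)

/-- The right side is y times the sum of (1-y)^j over j < 2k, and the terms j and 2k-1-j add up to
at least 2(1-y)^k. The formal proof is an induction. -/
theorem two_mul_mul_one_sub_pow_le (k : ℕ) {y : ℝ} (h0 : 0 ≤ y) (h1 : y ≤ 1) :
    2 * k * y * (1 - y) ^ k ≤ 1 - (1 - y) ^ (2 * k) := by
  induction k with
  | zero => simp
  | succ k ih =>
    have hp : 0 ≤ (1 - y) ^ k := pow_nonneg (by linarith) k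
    have hp1 : (1 - y) ^ k ≤ 1 := pow_le_one₀ (by linarith) (by linarith)
    have e1 : (1 - y) ^ (2 * (k + 1)) = ((1 - y) ^ k) ^ 2 * (1 - y) ^ 2 := by
      rw [← pow_mul, ← pow_add]; ring_nf
    have e2 : (1 - y) ^ (2 * k) = ((1 - y) ^ k) ^ 2 := by rw [← pow_mul]; ring_nf
    rw [e1, pow_succ (1 - y) k]
    rw [e2] at ih
    push_cast
    generalize (1 - y) ^ k = q at *
    have hq : (1 - y) * (2 * k * y * q) ≤ (1 - y) * (1 - q ^ 2) := by
      apply mul_le_mul_of_nonneg_left ih; linarith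
    -- This is exactly the gap that remains after multiplying the induction hypothesis by 1-y.
    have hs : 0 ≤ y * ((1 - y) * (1 - q) ^ 2 + y) :=
      mul_nonneg h0 (add_nonneg (mul_nonneg (by linarith) (sq_nonneg _)) h0)
    nlinarith

/-- The one-step inequality for the potential `(1 + (r / d) z) ^ (k + 1)` of a star with `d = k + Q`
edges, `k` of which are marked, when the last `r` edges are to be revealed. -/
theorem star_step_nonpos (k Q r : ℕ) (hr : 1 ≤ r) (hrd : r ≤ k + Q) {z : ℝ} (hz : 0 ≤ z) :
    k * ((1 + z) * (1 + ((r - 1 : ℕ) : ℝ) / ((k + Q - 1 : ℕ) : ℝ) * z) ^ k /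
        (1 + (r : ℝ) / ((k + Q : ℕ) : ℝ) * z) ^ (k + 1) - 1) +
      Q * ((((1 + ((r - 1 : ℕ) : ℝ) / ((k + Q - 1 : ℕ) : ℝ) * z) ^ (k + 1) /
        (1 + (r : ℝ) / ((k + Q : ℕ) : ℝ) * z) ^ (k + 1)) ^ 2 - 1) / 2) ≤ 0 := by
  obtain ⟨s, rfl⟩ : ∃ s, r = s + 1 := ⟨r - 1, by omega⟩
  obtain ⟨c, hc⟩ : ∃ c, k + Q = c + 1 := ⟨k + Q - 1, by omega⟩
  rw [hc, Nat.add_sub_cancel, Nat.add_sub_cancel]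
  have hsc : s ≤ c := by omega
  have hscR : (s : ℝ) ≤ c := by exact_mod_cast hsc
  have hQ : (Q : ℝ) = c + 1 - k := by
    have : (k : ℝ) + Q = c + 1 := by exact_mod_cast hc
    linarith
  have hQ0 : (0 : ℝ) ≤ Q := Nat.cast_nonneg _
  set A : ℝ := 1 + ((s + 1 : ℕ) : ℝ) / ((c + 1 : ℕ) : ℝ) * z with hA
  set B : ℝ := 1 + (s : ℝ) / (c : ℝ) * z with hB
  have hA1 : 1 ≤ A := by
    have : 0 ≤ ((s + 1 : ℕ) : ℝ) / ((c + 1 : ℕ) : ℝ) * z := by positivity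
    linarith
  have hB1 : 1 ≤ B := by
    have : 0 ≤ (s : ℝ) / (c : ℝ) * z := by positivity
    linarith
  have hA0 : 0 < A := by linarith
  -- Clearing denominators, (c+1)A - cB = 1 + z. This fails for c = 0, where s/c is 0 by convention,
  -- so a star with one edge is treated apart.
  have hkey : (1 + z = A + c * (A - B)) ∧ B ≤ A ∨ c = 0 := by
    rcases Nat.eq_zero_or_pos c with h | h
    · right; exact h
    · left
      have hc0 : (0 : ℝ) < c := by exact_mod_cast h
      have hAB : A - B = z * ((c - s) / (c * (c + 1))) := by
        rw [hA, hB]; push_cast; field_simp; ring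
      constructor
      · rw [hAB, hA]; push_cast; field_simp; ring
      · have : 0 ≤ z * ((c - s) / (c * (c + 1))) := by
          apply mul_nonneg hz; apply div_nonneg <;> nlinarith
        linarith
  rcases hkey with ⟨h1z, hBA⟩ | h
  · set y : ℝ := 1 - B / A with hy
    have hBy : B = (1 - y) * A := by rw [hy]; field_simp; ring
    have hy0 : 0 ≤ y := by
      have : B / A ≤ 1 := (div_le_one hA0).2 hBA
      linarith
    have hy1 : y ≤ 1 := by
      have : 0 ≤ B / A := by positivity
      linarith
    have e1 : (1 + z) * B ^ k / A ^ (k + 1) = (1 + c * y) * (1 - y) ^ k := by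
      rw [h1z, hBy, mul_pow]; field_simp; ring
    have e2 : (B ^ (k + 1) / A ^ (k + 1)) ^ 2 = (1 - y) ^ (2 * k) * (1 - y) ^ 2 := by
      rw [← div_pow, ← pow_mul, ← pow_add, show B / A = 1 - y by rw [hy]; ring]; ring_nf
    rw [e1, e2]
    have i1 := one_add_mul_one_sub_pow_le_one k hy0 hy1
    have i2 := two_mul_mul_one_sub_pow_le k hy0 hy1
    have i3 : (1 - y) ^ (2 * k) * (1 - y) ^ 2 ≤ (1 - y) ^ (2 * k) :=
      mul_le_of_le_one_right (pow_nonneg (by linarith) _) (by nlinarith)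
    have hk0 : (0 : ℝ) ≤ k := Nat.cast_nonneg _
    -- Splits 1 + cy into 1 + (k-1)y, controlled by `i1`, and Qy. The surplus kQy(1-y)^k is absorbed
    -- by the unmarked edges through `i2`.
    have hcc : (c : ℝ) = k - 1 + Q := by linarith
    rw [hcc]
    have j1 := mul_le_mul_of_nonneg_left i1 hk0
    have j2 := mul_le_mul_of_nonneg_left (i2.trans (sub_le_sub_left i3 1)) hQ0
    nlinarith
  · subst h
    have hs : s = 0 := by omega
    subst hs
    have hA' : A = 1 + z := by rw [hA]; simp
    have hB' : B = 1 := by rw [hB]; simp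
    rw [hB', hA']
    have hz1 : 1 ≤ 1 + z := by linarith
    have t1 : (1 + z) * 1 ^ k / (1 + z) ^ (k + 1) - 1 ≤ 0 := by
      rw [one_pow, mul_one, sub_nonpos, div_le_one (by positivity)]
      exact le_self_pow₀ hz1 (by omega)
    have t2 : ((1 : ℝ) ^ (k + 1) / (1 + z) ^ (k + 1)) ^ 2 ≤ 1 := by
      rw [one_pow]
      apply pow_le_one₀ (by positivity)
      rw [div_le_one (by positivity)]
      exact one_le_pow₀ hz1
    have u1 := mul_nonpos_of_nonneg_of_nonpos (Nat.cast_nonneg (α := ℝ) k) t1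
    have u2 : (Q : ℝ) * ((((1 : ℝ) ^ (k + 1) / (1 + z) ^ (k + 1)) ^ 2 - 1) / 2) ≤ 0 :=
      mul_nonpos_of_nonneg_of_nonpos hQ0 (by linarith)
    linarith

/-! ### Sums over the orderings of a finite set. -/

section Orders

variable {ι : Type*} [DecidableEq ι]

/-- The lists that enumerate the finite set `E` without repetition. -/
def orderings (E : Finset ι) : Finset (List ι) := ⟨E.val.lists, Multiset.lists_nodup_finset E⟩

theorem mem_orderings (E : Finset ι) (l : List ι) :
    l ∈ orderings E ↔ l.Nodup ∧ l.toFinset = E := by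
  rw [orderings, Finset.mem_mk, Multiset.mem_lists_iff]
  constructor
  · intro h
    have hn : l.Nodup := by
      have := E.nodup
      rw [h] at this
      exact this
    refine ⟨hn, ?_⟩
    ext x
    rw [List.mem_toFinset, ← Finset.mem_val, h]
    rfl
  · rintro ⟨hn, rfl⟩
    rw [List.toFinset_val, hn.dedup]
    rfl

theorem orderings_empty : orderings (∅ : Finset ι) = {[]} := by
  ext l
  rw [mem_orderings]
  simp only [List.toFinset_eq_empty_iff, Finset.mem_singleton]
  exact ⟨fun h => h.2, by rintro rfl; simp⟩

theorem sum_orderings_cons (E : Finset ι) (hE : E.Nonempty) (g : List ι → ℝ) :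
    ∑ l ∈ orderings E, g l = ∑ e ∈ E, ∑ l ∈ orderings (E.erase e), g (e :: l) := by
  rw [Finset.sum_sigma']
  symm
  refine Finset.sum_bij (fun p _ => p.1 :: p.2) ?_ ?_ ?_ ?_
  · rintro ⟨e, l⟩ h
    simp only [Finset.mem_sigma, mem_orderings] at h ⊢
    obtain ⟨he, hn, hl⟩ := h
    constructor
    · rw [List.nodup_cons]
      refine ⟨fun hm => ?_, hn⟩
      rw [← List.mem_toFinset, hl] at hm
      simp at hm
    · rw [List.toFinset_cons, hl, Finset.insert_erase he]
  · rintro ⟨e, l⟩ - ⟨e', l'⟩ - h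
    simp only [List.cons.injEq] at h
    obtain ⟨rfl, rfl⟩ := h
    rfl
  · intro l h
    rw [mem_orderings] at h
    obtain ⟨hn, hl⟩ := h
    cases l with
    | nil => simp at hl; simp [← hl] at hE
    | cons e l =>
      rw [List.nodup_cons] at hn
      refine ⟨⟨e, l⟩, ?_, rfl⟩
      simp only [Finset.mem_sigma, mem_orderings]
      refine ⟨by simp [← hl], hn.2, ?_⟩
      rw [← hl, List.toFinset_cons, Finset.erase_insert (by simpa using hn.1)]
  · rintro ⟨e, l⟩ _
    rfl

theorem card_orderings (E : Finset ι) : ((orderings E).card : ℝ) = E.card.factorial := by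
  induction hn : E.card generalizing E with
  | zero =>
    rw [Finset.card_eq_zero] at hn
    subst hn
    simp [orderings_empty]
  | succ n ih =>
    have hE : E.Nonempty := by rw [← Finset.card_pos]; omega
    have h := sum_orderings_cons E hE (fun _ => 1)
    simp only [Finset.sum_const, nsmul_eq_mul, mul_one] at h
    rw [h, Finset.sum_congr rfl (fun e he => ih (E.erase e) (by
      rw [Finset.card_erase_of_mem he]; omega))]
    simp [hn, Nat.factorial_succ]

end Orders

/-! ### The potential argument for overlapping stars. -/

section Potential

variable {ι V : Type*} [DecidableEq ι] [DecidableEq V]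

/-- The remaining numbers of slots once the edge `e` is revealed. -/
def decSlots (T : ι → Finset V) (e : ι) (r : V → ℕ) : V → ℕ :=
  fun x => if x ∈ T e then r x - 1 else r x

/-- Every marked edge that is among the first `r x` edges at `x` in the list contributes a factor
`1 + z`. -/
noncomputable def slotWeight (T : ι → Finset V) (P : ι → Prop) [DecidablePred P] (z : ℝ) :
    List ι → (V → ℕ) → ℝ
  | [], _ => 1
  | e :: l, r => (∏ x ∈ T e, if P e ∧ 0 < r x then 1 + z else 1) *
      slotWeight T P z l (decSlots T e r)

/-- The number of edges of `E` at `x`. -/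
def starCard (T : ι → Finset V) (E : Finset ι) (x : V) : ℕ := (E.filter fun e => x ∈ T e).card

/-- The number of marked edges of `E` at `x`. -/
def markCard (T : ι → Finset V) (P : ι → Prop) [DecidablePred P] (E : Finset ι) (x : V) : ℕ :=
  (E.filter fun e => x ∈ T e ∧ P e).card

/-- The potential of a star. -/
noncomputable def starPot (z : ℝ) (k d r : ℕ) : ℝ := (1 + (r : ℝ) / (d : ℝ) * z) ^ (k + 1)

theorem starPot_pos {z : ℝ} (hz : 0 ≤ z) (k d r : ℕ) : 0 < starPot z k d r := by
  unfold starPot; positivity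

theorem starPot_zero (z : ℝ) (k d : ℕ) : starPot z k d 0 = 1 := by simp [starPot]

variable (T : ι → Finset V) (P : ι → Prop) [DecidablePred P]

/-- The factor by which the potential at `x` changes when an edge at `x` is revealed. -/
noncomputable def starRatio (z : ℝ) (k d r : ℕ) (b : Prop) [Decidable b] : ℝ :=
  if r = 0 then 1 else
    if b then (1 + z) * starPot z (k - 1) (d - 1) (r - 1) / starPot z k d r
    else starPot z k (d - 1) (r - 1) / starPot z k d r

theorem starCard_erase {E : Finset ι} {e : ι} (he : e ∈ E) (x : V) :
    starCard T (E.erase e) x = if x ∈ T e then starCard T E x - 1 else starCard T E x := by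
  unfold starCard
  rw [Finset.filter_erase]
  split_ifs with h
  · rw [Finset.card_erase_of_mem (by simp [he, h])]
  · rw [Finset.erase_eq_of_notMem (by simp [h])]

theorem markCard_erase {E : Finset ι} {e : ι} (he : e ∈ E) (x : V) :
    markCard T P (E.erase e) x =
      if x ∈ T e ∧ P e then markCard T P E x - 1 else markCard T P E x := by
  unfold markCard
  rw [Finset.filter_erase]
  split_ifs with h
  · rw [Finset.card_erase_of_mem (by simp [he, h])]
  · rw [Finset.erase_eq_of_notMem (by simp [h])]

omit [DecidableEq ι] in
theorem markCard_le_starCard (E : Finset ι) (x : V) : markCard T P E x ≤ starCard T E x :=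
  Finset.card_le_card fun e he => by simp only [Finset.mem_filter] at he ⊢; exact ⟨he.1, he.2.1⟩

/-- Only the stars containing e change. A star without remaining slots has potential 1 before and
after, which is why `starRatio` is 1 there. -/
theorem potential_erase {N : Finset V} {E : Finset ι} {e : ι} (he : e ∈ E) (hT : T e ⊆ N)
    {z : ℝ} (hz : 0 ≤ z) (r : V → ℕ) :
    (∏ x ∈ T e, if P e ∧ 0 < r x then 1 + z else 1) *
        ∏ x ∈ N, starPot z (markCard T P (E.erase e) x) (starCard T (E.erase e) x)
          (decSlots T e r x) =
      (∏ x ∈ N, starPot z (markCard T P E x) (starCard T E x) (r x)) *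
        ∏ x ∈ T e, starRatio z (markCard T P E x) (starCard T E x) (r x) (P e) := by
  rw [← Finset.inter_eq_right.2 hT, ← Finset.filter_mem_eq_inter, Finset.prod_filter,
    Finset.prod_filter, ← Finset.prod_mul_distrib, ← Finset.prod_mul_distrib]
  refine Finset.prod_congr rfl fun x _ => ?_
  rw [starCard_erase T he, markCard_erase T P he]
  unfold decSlots starRatio
  have hp := (starPot_pos hz (markCard T P E x) (starCard T E x) (r x)).ne'
  by_cases hx : x ∈ T e
  · by_cases hr : r x = 0
    · simp [hx, hr, starPot_zero]
    · have hr' : 0 < r x := Nat.pos_of_ne_zero hr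
      by_cases hP : P e
      · simp only [hx, hr, hP, hr', if_true, if_false, and_self]
        field_simp
      · simp only [hx, hr, hP, hr', if_true, if_false, and_false, false_and, one_mul]
        field_simp
  · simp [hx]

/-- The increment charged to `x` when an edge at `x` is revealed. -/
noncomputable def starCharge (z : ℝ) (k d r : ℕ) (b : Prop) [Decidable b] : ℝ :=
  if b then starRatio z k d r b - 1 else (starRatio z k d r b ^ 2 - 1) / 2

-- Decouples the stars: a marked edge has a single factor, and for an unmarked one the product is
-- bounded by the mean of the squares. The charges can then be summed star by star.
omit [DecidableEq ι] in
theorem prod_starRatio_le (e : ι) (hT2 : (T e).card ≤ 2) (hP : P e → (T e).card = 1) (z : ℝ)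
    (k d r : V → ℕ) :
    ∏ x ∈ T e, starRatio z (k x) (d x) (r x) (P e) ≤
      1 + ∑ x ∈ T e, starCharge z (k x) (d x) (r x) (P e) := by
  unfold starCharge
  by_cases h : P e
  · obtain ⟨x, hx⟩ := Finset.card_eq_one.1 (hP h)
    simp [hx, h]
  · simp only [h, if_false]
    obtain h0 | h1 | h2 : (T e).card = 0 ∨ (T e).card = 1 ∨ (T e).card = 2 := by omega
    · rw [Finset.card_eq_zero] at h0
      simp [h0]
    · obtain ⟨x, hx⟩ := Finset.card_eq_one.1 h1
      rw [hx, Finset.prod_singleton, Finset.sum_singleton]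
      nlinarith [sq_nonneg (starRatio z (k x) (d x) (r x) False - 1)]
    · obtain ⟨x, y, hxy, hx⟩ := Finset.card_eq_two.1 h2
      rw [hx, Finset.prod_pair hxy, Finset.sum_pair hxy]
      nlinarith [sq_nonneg (starRatio z (k x) (d x) (r x) False -
        starRatio z (k y) (d y) (r y) False)]

omit [DecidableEq ι] in
theorem sum_starCharge_nonpos (E : Finset ι) (x : V) (r : ℕ) (hr : r ≤ starCard T E x) {z : ℝ}
    (hz : 0 ≤ z) :
    ∑ e ∈ E.filter (fun e => x ∈ T e),
      starCharge z (markCard T P E x) (starCard T E x) r (P e) ≤ 0 := by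
  rcases Nat.eq_zero_or_pos r with h0 | h0
  · subst h0
    simp [starCharge, starRatio]
  rw [← Finset.sum_filter_add_sum_filter_not _ P]
  rw [Finset.sum_congr rfl (g := fun _ => starCharge z (markCard T P E x) (starCard T E x) r True)
    (fun e he => by simp [(Finset.mem_filter.1 he).2])]
  rw [Finset.sum_congr (s₁ := Finset.filter (fun e => ¬P e) _) rfl
    (g := fun _ => starCharge z (markCard T P E x) (starCard T E x) r False)
    (fun e he => by simp [(Finset.mem_filter.1 he).2])]
  rw [Finset.sum_const, Finset.sum_const, nsmul_eq_mul, nsmul_eq_mul]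
  have hk : (Finset.filter P (E.filter fun e => x ∈ T e)).card = markCard T P E x := by
    rw [Finset.filter_filter]; rfl
  obtain ⟨Q, hQ⟩ := Nat.exists_eq_add_of_le (markCard_le_starCard T P E x)
  have hQ' : (Finset.filter (fun e => ¬P e) (E.filter fun e => x ∈ T e)).card = Q := by
    have := Finset.card_filter_add_card_filter_not (s := E.filter fun e => x ∈ T e) P
    rw [hk] at this
    change _ = starCard T E x at this
    omega
  rw [hk, hQ', hQ]
  rw [hQ] at hr
  generalize markCard T P E x = k at *
  have := star_step_nonpos k Q r h0 hr hz
  refine le_trans (le_of_eq ?_) this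
  unfold starCharge starRatio starPot
  simp only [if_true, if_false, h0.ne']
  -- For k = 0 the truncated exponent (k - 1) + 1 is wrong, but its term is multiplied by k.
  rcases Nat.eq_zero_or_pos k with hk0 | hk0
  · subst hk0; simp
  · rw [Nat.sub_add_cancel hk0]

/-- The exponential moment of the number of marked edges among the first `r x` edges at `x` of a
uniformly random list of the edges in `E`. -/
theorem sum_slotWeight_le (N : Finset V) (hTN : ∀ e, T e ⊆ N) (hT2 : ∀ e, (T e).card ≤ 2)
    (hP : ∀ e, P e → (T e).card = 1) {z : ℝ} (hz : 0 ≤ z) (E : Finset ι) (r : V → ℕ)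
    (hr : ∀ x ∈ N, r x ≤ starCard T E x) :
    ∑ l ∈ orderings E, slotWeight T P z l r ≤
      E.card.factorial * ∏ x ∈ N, starPot z (markCard T P E x) (starCard T E x) (r x) := by
  induction hn : E.card generalizing E r with
  | zero =>
    rw [Finset.card_eq_zero] at hn
    subst hn
    rw [orderings_empty, Finset.sum_singleton, Nat.factorial_zero, Nat.cast_one, one_mul]
    rw [Finset.prod_congr rfl (g := fun _ => (1 : ℝ)), Finset.prod_const_one]
    · rfl
    · intro x hx
      have := hr x hx
      simp only [starCard, Finset.filter_empty, Finset.card_empty, Nat.le_zero] at this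
      rw [this, starPot_zero]
  | succ n ih =>
    have hE : E.Nonempty := by rw [← Finset.card_pos]; omega
    set Φ := ∏ x ∈ N, starPot z (markCard T P E x) (starCard T E x) (r x) with hΦ
    have hΦ0 : 0 ≤ Φ := Finset.prod_nonneg fun x _ => (starPot_pos hz _ _ _).le
    have hstep : ∀ e ∈ E, ∑ l ∈ orderings (E.erase e), slotWeight T P z (e :: l) r ≤
        n.factorial * (Φ *
          (1 + ∑ x ∈ T e, starCharge z (markCard T P E x) (starCard T E x) (r x) (P e))) := by
      intro e he
      have hcard : (E.erase e).card = n := by rw [Finset.card_erase_of_mem he]; omega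
      have h1 := ih (E.erase e) (decSlots T e r) (fun x hx => by
        rw [starCard_erase T he]
        unfold decSlots
        have := hr x hx
        split_ifs <;> omega) hcard
      simp only [slotWeight]
      rw [← Finset.mul_sum]
      have hw : 0 ≤ ∏ x ∈ T e, (if P e ∧ 0 < r x then 1 + z else 1) :=
        Finset.prod_nonneg fun x _ => by split_ifs <;> linarith
      refine (mul_le_mul_of_nonneg_left h1 hw).trans ?_
      rw [mul_left_comm, potential_erase T P he (hTN e) hz r]
      gcongr
      exact prod_starRatio_le T P e (hT2 e) (hP e) z _ _ _
    rw [sum_orderings_cons E hE]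
    refine (Finset.sum_le_sum hstep).trans ?_
    rw [← Finset.mul_sum, ← Finset.mul_sum, Finset.sum_add_distrib, Finset.sum_const, hn]
    -- The average over the revealed edge is regrouped by stars, each of which has nonpositive total
    -- charge.
    have hswap : ∑ e ∈ E, ∑ x ∈ T e,
        starCharge z (markCard T P E x) (starCard T E x) (r x) (P e) =
        ∑ x ∈ N, ∑ e ∈ E.filter (fun e => x ∈ T e),
          starCharge z (markCard T P E x) (starCard T E x) (r x) (P e) := by
      apply Finset.sum_comm'
      intro e x
      simp only [Finset.mem_filter]
      constructor
      · exact fun h => ⟨⟨h.1, h.2⟩, hTN e h.2⟩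
      · exact fun h => h.1
    have hneg : ∑ e ∈ E, ∑ x ∈ T e,
        starCharge z (markCard T P E x) (starCard T E x) (r x) (P e) ≤ 0 := by
      rw [hswap]
      exact Finset.sum_nonpos fun x hx => sum_starCharge_nonpos T P E x (r x) (hr x hx) hz
    rw [Nat.factorial_succ]
    push_cast
    have hf : (0 : ℝ) ≤ n.factorial := Nat.cast_nonneg _
    simp only [nsmul_eq_mul, mul_one]
    push_cast
    calc (n.factorial : ℝ) * (Φ * ((n : ℝ) + 1 + _)) ≤ n.factorial * (Φ * ((n : ℝ) + 1 + 0)) := by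
          gcongr
      _ = _ := by ring

end Potential

/-! ### Red degrees and recent edges. -/

section Recent

/-- The red and the black degree of a vertex of degree `d`. -/
noncomputable def redBlack (φ : ℝ) : ℕ → ℕ × ℕ
  | 0 => (0, 0)
  | d + 1 =>
    if φ * ((redBlack φ d).2 : ℝ) ≤ ((redBlack φ d).1 + 1 : ℕ) then
      (0, (redBlack φ d).2 + ((redBlack φ d).1 + 1))
    else ((redBlack φ d).1 + 1, (redBlack φ d).2)

theorem redBlack_add (φ : ℝ) (d : ℕ) : (redBlack φ d).1 + (redBlack φ d).2 = d := by
  induction d with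
  | zero => simp [redBlack]
  | succ d ih =>
    rw [redBlack]
    split_ifs
    · simp only; omega
    · simp only; omega

theorem redBlack_le {φ : ℝ} (hφ : 0 ≤ φ) (d : ℕ) :
    ((redBlack φ d).1 : ℝ) ≤ φ * (redBlack φ d).2 := by
  cases d with
  | zero => simp [redBlack]
  | succ d =>
    rw [redBlack]
    split_ifs with h
    · simp only [Nat.cast_zero]; positivity
    · exact (not_le.1 h).le

theorem red_le_mul {φ : ℝ} (hφ : 0 ≤ φ) (d : ℕ) :
    ((redBlack φ d).1 : ℝ) ≤ φ / (1 + φ) * d := by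
  have h1 := redBlack_le hφ d
  have h2 : ((redBlack φ d).1 : ℝ) + (redBlack φ d).2 = d := by exact_mod_cast redBlack_add φ d
  rw [div_mul_eq_mul_div, le_div_iff₀ (by linarith), ← h2]
  linarith

/-- A nonzero red degree means that no batch was just performed, so the red edges are the previous
ones and the new one. -/
theorem red_succ_of_ne_zero {φ : ℝ} {d : ℕ} (h : (redBlack φ (d + 1)).1 ≠ 0) :
    (redBlack φ (d + 1)).1 = (redBlack φ d).1 + 1 := by
  rw [redBlack] at h ⊢
  split_ifs at h ⊢ with hc
  · exact absurd rfl h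
  · rfl

variable {V : Type*} [DecidableEq V]

/-- The first `j` edges at `x` in a list of edges. -/
def recentAt (x : V) : List (Sym2 V) → ℕ → Set (Sym2 V)
  | [], _ => ∅
  | e :: m, j => if x ∈ e then (if j = 0 then ∅ else insert e (recentAt x m (j - 1)))
      else recentAt x m j

@[simp] theorem recentAt_zero (x : V) (m : List (Sym2 V)) : recentAt x m 0 = ∅ := by
  induction m with
  | nil => rfl
  | cons e m ih => simp [recentAt, ih]

theorem recentAt_subset (x : V) (m : List (Sym2 V)) (j : ℕ) :
    recentAt x m j ⊆ {e | e ∈ m ∧ x ∈ e} := by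
  induction m generalizing j with
  | nil => simp [recentAt]
  | cons e m ih =>
    intro f hf
    unfold recentAt at hf
    split_ifs at hf with h1 h2
    · simp at hf
    · rcases hf with rfl | hf
      · simp [h1]
      · have := ih _ hf
        simp only [Set.mem_ofPred_eq, List.mem_cons] at this ⊢
        exact ⟨Or.inr this.1, this.2⟩
    · have := ih _ hf
      simp only [Set.mem_ofPred_eq, List.mem_cons] at this ⊢
      exact ⟨Or.inr this.1, this.2⟩

/-- The marked edges that are recent at one of their tracked endpoints. -/
def recentMarked (T : Sym2 V → Finset V) (P : Sym2 V → Prop) (m : List (Sym2 V)) (r : V → ℕ) :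
    Set (Sym2 V) :=
  {e | P e ∧ ∃ x ∈ T e, e ∈ recentAt x m (r x)}

theorem recentMarked_finite (T : Sym2 V → Finset V) (P : Sym2 V → Prop) (m : List (Sym2 V))
    (r : V → ℕ) : (recentMarked T P m r).Finite := by
  refine (List.finite_toSet m).subset ?_
  rintro e ⟨-, x, -, he⟩
  exact (recentAt_subset x m _ he).1

/-- Peeling off the head e, a recent marked edge is either e itself with a slot left at a tracked
endpoint, or recent in the tail with the slots decremented. Only an inequality holds, as an edge
recent at two tracked endpoints is weighted twice but counted once. -/
theorem pow_recentMarked_le (T : Sym2 V → Finset V) (P : Sym2 V → Prop) [DecidablePred P]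
    (N : Finset V) (hT : ∀ e x, x ∈ T e ↔ x ∈ N ∧ x ∈ e) {z : ℝ} (hz : 0 ≤ z)
    (m : List (Sym2 V)) (r : V → ℕ) :
    (1 + z) ^ (recentMarked T P m r).ncard ≤ slotWeight T P z m r := by
  induction m generalizing r with
  | nil => simp [recentMarked, recentAt, slotWeight]
  | cons e m ih =>
    have hz1 : 1 ≤ 1 + z := by linarith
    have hsub : recentMarked T P (e :: m) r ⊆
        {f | f = e ∧ P e ∧ ∃ x ∈ T e, 0 < r x} ∪ recentMarked T P m (decSlots T e r) := by
      rintro f ⟨hP, x, hx, hf⟩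
      have hxN := ((hT f x).1 hx).1
      unfold recentAt at hf
      split_ifs at hf with h1 h2
      · simp at hf
      · have hxe : x ∈ T e := (hT e x).2 ⟨hxN, h1⟩
        rcases hf with rfl | hf
        · exact Or.inl ⟨rfl, hP, x, hx, Nat.pos_of_ne_zero h2⟩
        · refine Or.inr ⟨hP, x, hx, ?_⟩
          simpa [decSlots, hxe] using hf
      · have hxe : x ∉ T e := fun h => h1 ((hT e x).1 h).2
        refine Or.inr ⟨hP, x, hx, ?_⟩
        simpa [decSlots, hxe] using hf
    have hfin : ({f | f = e ∧ P e ∧ ∃ x ∈ T e, 0 < r x} : Set (Sym2 V)).Finite :=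
      (Set.finite_singleton e).subset fun f hf => hf.1
    have h1 := (Set.ncard_le_ncard hsub (hfin.union (recentMarked_finite T P m _))).trans
      (Set.ncard_union_le _ _)
    refine (pow_le_pow_right₀ hz1 h1).trans ?_
    rw [pow_add]
    unfold slotWeight
    have h0 : (1 : ℝ) ≤ ∏ x ∈ T e, if P e ∧ 0 < r x then 1 + z else 1 :=
      Finset.one_le_prod fun x _ => by split_ifs <;> linarith
    refine mul_le_mul ?_ (ih _) (by positivity) (by linarith)
    by_cases h : P e ∧ ∃ x ∈ T e, 0 < r x
    · obtain ⟨hP, x, hx, hr⟩ := h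
      have hs : ({f | f = e ∧ P e ∧ ∃ x ∈ T e, 0 < r x} : Set (Sym2 V)).ncard ≤ 1 :=
        (Set.ncard_le_ncard (fun f hf => hf.1) (Set.finite_singleton e)).trans
          (Set.ncard_singleton e).le
      refine (pow_le_pow_right₀ hz1 hs).trans ?_
      rw [pow_one]
      calc 1 + z = if P e ∧ 0 < r x then 1 + z else 1 := by simp [hP, hr]
        _ ≤ _ := by
          rw [← Finset.mul_prod_erase _ _ hx]
          refine le_mul_of_one_le_right (by split_ifs <;> linarith) ?_
          exact Finset.one_le_prod fun x _ => by split_ifs <;> linarith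
    · have hs : ({f | f = e ∧ P e ∧ ∃ x ∈ T e, 0 < r x} : Set (Sym2 V)) = ∅ := by
        ext f; simp only [Set.mem_ofPred_eq, Set.mem_empty_iff_false, iff_false]
        exact fun hf => h hf.2
      rw [hs, Set.ncard_empty, pow_zero]
      exact h0

end Recent

/-! ### The invariant of the lazy algorithm. -/

section Algorithm

variable {V : Type*}

theorem mem_graphBall_one_iff {G : SimpleGraph V} {x y : V} : y ∈ ball G 1 x ↔ G.Adj x y ∨ x = y := by
  simp [ball, SimpleGraph.edist_le_one_iff_adj_or_eq]

theorem mem_graphBall_two_of {G : SimpleGraph V} {x y z : V} (hxy : y ∈ ball G 1 x)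
    (hyz : z ∈ ball G 1 y) : z ∈ ball G 2 x := by
  simp only [ball, Set.mem_ofPred_eq] at *
  refine (SimpleGraph.edist_triangle (v := y)).trans ((add_le_add hxy hyz).trans ?_)
  norm_num

theorem graphBall_mono {G G' : SimpleGraph V} (h : G ≤ G') (k : ℕ) (x : V) :
    ball G k x ⊆ ball G' k x := fun _ hy => (SimpleGraph.edist_anti h).trans hy

/-- The state `s` stores sound balls; whenever `D u x` holds, the 2-ball of `u` contains the 1-ball
of `x` with the possible exception of the vertices in `pend x`. -/
structure Tracks (s : LazyState V) (D : V → V → Prop) (pend : V → Set V) : Prop where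
  self_mem : ∀ x, x ∈ s.apx1 x
  self_mem_two : ∀ x, x ∈ s.apx2 x
  subset_one : ∀ x, s.apx1 x ⊆ ball s.graph 1 x
  subset_two : ∀ x, s.apx2 x ⊆ ball s.graph 2 x
  mem_one : ∀ x y, D x y → y ∈ s.apx1 x
  adj : ∀ x y, D x y → s.graph.Adj x y
  pend_irrefl : ∀ x, x ∉ pend x
  cover : ∀ u x w, D u x → w ∈ s.apx1 x → w ∉ pend x → w ∈ s.apx2 u

theorem Tracks.mono_graph {s : LazyState V} {D : V → V → Prop} {pend : V → Set V}
    (h : Tracks s D pend) {G : SimpleGraph V} (hG : s.graph ≤ G) :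
    Tracks { s with graph := G } D pend where
  self_mem := h.self_mem
  self_mem_two := h.self_mem_two
  subset_one x := (h.subset_one x).trans (graphBall_mono hG 1 x)
  subset_two x := (h.subset_two x).trans (graphBall_mono hG 2 x)
  mem_one := h.mem_one
  adj x y hxy := hG (h.adj x y hxy)
  pend_irrefl := h.pend_irrefl
  cover := h.cover

-- The heavy update covers the new pair (x, y) entirely. The only new deficit is that earlier
-- neighbours of x may lack y, so only y becomes pending at x.
open Classical in
theorem Tracks.merge {s : LazyState V} {D : V → V → Prop} {pend : V → Set V}
    (h : Tracks s D pend) {x y : V} (hxy : s.graph.Adj x y) :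
    Tracks (((s.grow x y).heavy x y).incRed x) (fun a b => D a b ∨ (a = x ∧ b = y))
      (Function.update pend x (insert y (pend x))) where
  self_mem z := by
    have := h.self_mem z
    simp only [LazyState.grow, LazyState.heavy, LazyState.incRed, Function.update_apply]
    split_ifs with hz
    · subst hz; exact Or.inl this
    · exact this
  self_mem_two z := by
    have := h.self_mem_two z
    simp only [LazyState.grow, LazyState.heavy, LazyState.incRed, Function.update_apply]
    split_ifs with hz
    · subst hz; exact Or.inl this
    · subst hz; exact Or.inl this
    · exact this
  subset_one z := by
    have := h.subset_one z
    simp only [LazyState.grow, LazyState.heavy, LazyState.incRed, Function.update_apply]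
    split_ifs with hz
    · subst hz
      refine Set.union_subset this ?_
      rintro _ rfl
      exact mem_graphBall_one_iff.2 (Or.inl hxy)
    · exact this
  subset_two z := by
    have := h.subset_two z
    have h1 := h.subset_one y
    have hne := hxy.ne'
    simp only [LazyState.grow, LazyState.heavy, LazyState.incRed, Function.update_apply, hne,
      if_false]
    split_ifs with hz
    · subst hz
      refine Set.union_subset this fun w hw => ?_
      exact mem_graphBall_two_of (mem_graphBall_one_iff.2 (Or.inl hxy)) (h1 hw)
    · exact this
  mem_one a b hab := by
    simp only [LazyState.grow, LazyState.heavy, LazyState.incRed, Function.update_apply]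
    rcases hab with hab | ⟨rfl, rfl⟩
    · have := h.mem_one a b hab
      split_ifs with hz
      · subst hz; exact Or.inl this
      · exact this
    · simp
  adj a b hab := by
    rcases hab with hab | ⟨rfl, rfl⟩
    · exact h.adj a b hab
    · exact hxy
  pend_irrefl z := by
    have := h.pend_irrefl z
    simp only [Function.update_apply]
    split_ifs with hz
    · subst hz
      simp [hxy.ne, this]
    · exact this
  cover a b w hab hw hp := by
    have hne := hxy.ne'
    simp only [LazyState.grow, LazyState.heavy, LazyState.incRed, Function.update_apply, hne,
      if_false] at hw hp ⊢
    have key : w ∈ s.apx1 b ∧ w ∉ pend b ∨ (a = x ∧ b = y) ∧ w ∈ s.apx1 b → w ∈ if a = x then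
        s.apx2 x ∪ s.apx1 y else s.apx2 a := by
      rintro (⟨h1, h2⟩ | ⟨⟨rfl, rfl⟩, h1⟩)
      · rcases hab with hab | ⟨rfl, rfl⟩
        · have := h.cover a b w hab h1 h2
          split_ifs with ha
          · subst ha; exact Or.inl this
          · exact this
        · simp [h1]
      · simp [h1]
    apply key
    by_cases hb : b = x
    · subst hb
      simp only [if_true, Set.mem_insert_iff, not_or] at hw hp
      rcases hw with hw | hw
      · exact Or.inl ⟨hw, hp.2⟩
      · exact absurd hw hp.1
    · simp only [hb, if_false] at hw hp
      exact Or.inl ⟨hw, hp⟩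

-- Every u with `D u x` is a current neighbour of x and receives the whole 1-ball of x, so nothing
-- stays pending at x.
open Classical in
theorem Tracks.batch {s : LazyState V} {D : V → V → Prop} {pend : V → Set V}
    (h : Tracks s D pend) (x : V) : Tracks (s.batch x) D (Function.update pend x ∅) where
  self_mem := h.self_mem
  self_mem_two z := by
    have := h.self_mem_two z
    simp only [LazyState.batch]
    split_ifs
    · exact Or.inl this
    · exact this
  subset_one := h.subset_one
  subset_two z := by
    have := h.subset_two z
    simp only [LazyState.batch]
    split_ifs with hz
    · refine Set.union_subset this fun w hw => ?_
      exact mem_graphBall_two_of (mem_graphBall_one_iff.2 (Or.inl hz.symm)) (h.subset_one x hw)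
    · exact this
  mem_one := h.mem_one
  adj := h.adj
  pend_irrefl z := by
    have := h.pend_irrefl z
    simp only [Function.update_apply]
    split_ifs
    · simp
    · exact this
  cover a b w hab hw hp := by
    simp only [LazyState.batch, Function.update_apply] at hw hp ⊢
    by_cases hb : b = x
    · subst hb
      simp [(h.adj a b hab).symm, hw]
    · simp only [hb, if_false] at hp
      have := h.cover a b w hab hw hp
      split_ifs
      · exact Or.inl this
      · exact this

open Classical in
theorem process_tracks {s : LazyState V} {D : V → V → Prop} {pend : V → Set V} {deg : V → ℕ}
    {φ : ℝ} (h : Tracks s D pend) (hdeg : ∀ z, (s.red z, s.black z) = redBlack φ (deg z))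
    {x y : V} (hxy : s.graph.Adj x y) :
    Tracks (s.process φ x y) (fun a b => D a b ∨ (a = x ∧ b = y))
      (Function.update pend x
        (if (redBlack φ (deg x + 1)).1 = 0 then ∅ else insert y (pend x))) ∧
    (∀ z, ((s.process φ x y).red z, (s.process φ x y).black z) =
      redBlack φ (Function.update deg x (deg x + 1) z)) ∧
    (s.process φ x y).graph = s.graph := by
  have hx := hdeg x
  have hm := h.merge hxy
  unfold LazyState.process LazyState.check
  have e1 : (((s.grow x y).heavy x y).incRed x).red x = s.red x + 1 := by
    simp [LazyState.grow, LazyState.heavy, LazyState.incRed]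
  have e2 : (((s.grow x y).heavy x y).incRed x).black x = s.black x := rfl
  rw [e1, e2]
  have hr : redBlack φ (deg x + 1) = if φ * (s.black x : ℝ) ≤ (s.red x + 1 : ℕ) then
      (0, s.black x + (s.red x + 1)) else (s.red x + 1, s.black x) := by
    rw [redBlack, ← hx]
  rw [hr]
  split_ifs with hc h0 h0
  · refine ⟨?_, fun z => ?_, rfl⟩
    · have := hm.batch x
      rwa [Function.update_idem] at this
    · by_cases hz : z = x
      · subst hz
        simp only [Function.update_self, hr, if_pos hc]
        simp [LazyState.batch, LazyState.grow, LazyState.heavy, LazyState.incRed]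
      · simp [Function.update_of_ne hz, LazyState.batch, LazyState.grow, LazyState.heavy,
          LazyState.incRed, hdeg z]
  · exact absurd rfl h0
  · exact absurd h0 (by simp)
  · refine ⟨hm, fun z => ?_, rfl⟩
    by_cases hz : z = x
    · subst hz
      simp only [Function.update_self, hr, if_neg hc]
      simp [LazyState.grow, LazyState.heavy, LazyState.incRed]
    · simp [Function.update_of_ne hz, LazyState.grow, LazyState.heavy,
        LazyState.incRed, hdeg z]

-- The list has the newest edge first, so `recentAt` picks the last edges inserted at x: those still
-- red. Between the two halves of an insertion the relation holds for one direction of the new edge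
-- only, hence a relation on ordered pairs in `Tracks`.
open Classical in
theorem foldr_tracks (φ : ℝ) (ends : Sym2 V → V × V)
    (hends : ∀ e : Sym2 V, s((ends e).1, (ends e).2) = e) (m : List (Sym2 V))
    (hm : ∀ e ∈ m, ¬ e.IsDiag) :
    let s := m.foldr (fun e s => LazyState.insertEdge φ s (ends e)) (LazyState.init ⊥)
    Tracks s (fun a b => s(a, b) ∈ m)
      (fun x => {w | s(x, w) ∈ recentAt x m (redBlack φ (m.countP (x ∈ ·))).1}) ∧
    (∀ x, (s.red x, s.black x) = redBlack φ (m.countP (x ∈ ·))) ∧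
    s.graph = SimpleGraph.fromEdgeSet {e | e ∈ m} := by
  induction m with
  | nil =>
    refine ⟨⟨?_, ?_, ?_, ?_, ?_, ?_, ?_, ?_⟩, ?_, ?_⟩ <;>
      simp [LazyState.init, ball, recentAt, redBlack]
  | cons e m ih =>
    obtain ⟨h1, h2, h3⟩ := ih fun f hf => hm f (List.mem_cons_of_mem _ hf)
    rw [List.foldr_cons]
    generalize m.foldr (fun e s => LazyState.insertEdge φ s (ends e)) (LazyState.init ⊥) = s at *
    have hab := hends e
    have hd := hm e (List.mem_cons_self ..)
    generalize ends e = p at *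
    obtain ⟨a, b⟩ := p
    simp only at hab
    subst hab
    have hne : a ≠ b := by simpa using hd
    have hadj : (s.graph ⊔ SimpleGraph.edge a b).Adj a b :=
      Or.inr (SimpleGraph.edge_adj a b a b |>.2 ⟨Or.inl ⟨rfl, rfl⟩, hne⟩)
    have t0 := h1.mono_graph (le_sup_left : s.graph ≤ s.graph ⊔ SimpleGraph.edge a b)
    obtain ⟨t1, d1, g1⟩ := process_tracks (φ := φ) t0 h2 (x := a) (y := b) hadj
    have hadj' := hadj.symm
    rw [show s.graph ⊔ SimpleGraph.edge a b = _ from g1.symm] at hadj'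
    obtain ⟨t2, d2, g2⟩ := process_tracks t1 d1 (x := b) (y := a) hadj'
    simp only [LazyState.insertEdge]
    have hdegs : (Function.update (Function.update (fun x => m.countP (x ∈ ·)) a
        (m.countP (a ∈ ·) + 1)) b (Function.update (fun x => m.countP (x ∈ ·)) a
        (m.countP (a ∈ ·) + 1) b + 1)) = fun x => (s(a, b) :: m).countP (x ∈ ·) := by
      funext x
      rw [List.countP_cons]
      by_cases hxb : x = b
      · subst hxb
        simp [hne.symm]
      · by_cases hxa : x = a
        · subst hxa
          simp [hne]
        · simp [hxa, hxb]
    refine ⟨?_, fun x => ?_, ?_⟩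
    · convert t2 using 1
      · funext x y
        simp only [List.mem_cons, Sym2.eq_iff, eq_iff_iff]
        tauto
      · funext x
        have hc : ∀ z, z = a ∨ z = b →
            (s(a, b) :: m).countP (z ∈ ·) = m.countP (z ∈ ·) + 1 := by
          intro z hz
          rw [List.countP_cons_of_pos]
          simpa using hz
        have hset : ∀ z y, (z = a ∧ y = b ∨ z = b ∧ y = a) →
            {w | s(z, w) ∈ recentAt z (s(a, b) :: m)
              (redBlack φ ((s(a, b) :: m).countP (z ∈ ·))).1} =
            if (redBlack φ (m.countP (z ∈ ·) + 1)).1 = 0 then ∅ else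
              insert y {w | s(z, w) ∈ recentAt z m (redBlack φ (m.countP (z ∈ ·))).1} := by
          intro z y hzy
          have hz : z = a ∨ z = b := by tauto
          have he : s(a, b) = s(z, y) := by
            rcases hzy with ⟨rfl, rfl⟩ | ⟨rfl, rfl⟩
            · rfl
            · exact Sym2.eq_swap
          rw [hc z hz]
          split_ifs with h0
          · rw [h0]; simp
          · rw [red_succ_of_ne_zero h0, he]
            have hzy' : z ≠ y := by
              rintro rfl
              rcases hzy with ⟨rfl, rfl⟩ | ⟨rfl, rfl⟩ <;> exact hne rfl
            ext w
            simp [recentAt, hzy']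
        by_cases hxb : x = b
        · subst hxb
          rw [Function.update_self, hset x a (Or.inr ⟨rfl, rfl⟩), Function.update_of_ne hne.symm,
            Function.update_of_ne hne.symm]
        · rw [Function.update_of_ne hxb]
          by_cases hxa : x = a
          · subst hxa
            rw [Function.update_self, hset x b (Or.inl ⟨rfl, rfl⟩)]
          · rw [Function.update_of_ne hxa, List.countP_cons_of_neg (by simp [hxa, hxb])]
            simp [recentAt, hxa, hxb]
    · rw [d2]
      exact congrArg _ (congrFun hdegs x)
    · rw [g2, g1, h3]
      ext x y
      simp only [SimpleGraph.sup_adj, SimpleGraph.fromEdgeSet_adj, SimpleGraph.edge_adj,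
        Set.mem_ofPred_eq, List.mem_cons, Sym2.eq_iff]
      tauto

end Algorithm

/-! ### Hoeffding's estimate. -/

section Hoeffding

-- Hoeffding's lemma for a Bernoulli variable with mean p, with the centring undone.
open MeasureTheory ProbabilityTheory in
theorem one_add_mul_exp_sub_one_le {p : ℝ} (h0 : 0 ≤ p) (h1 : p ≤ 1) (t : ℝ) :
    1 + p * (Real.exp t - 1) ≤ Real.exp (t * p + t ^ 2 / 8) := by
  set μ : Measure ℝ := bernoulliMeasure 1 0 ⟨p, h0, h1⟩ with hμ
  have hint : ∀ f : ℝ → ℝ, ∫ x, f x ∂μ = p * f 1 + (1 - p) * f 0 := by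
    intro f
    rw [hμ, integral_bernoulliMeasure]
    simp
  have hX : μ[fun x => x] = p := by rw [hint]; ring
  have hb : ∀ᵐ x ∂μ, (fun x : ℝ => x) x ∈ Set.Icc (0 : ℝ) 1 := by
    rw [ae_iff]
    exact bernoulliMeasure_apply_of_notMem_of_notMem _ (by measurability) (by simp) (by simp)
  have h := (hasSubgaussianMGF_of_mem_Icc (μ := μ) (X := fun x => x) (a := 0) (b := 1)
    aemeasurable_id hb).mgf_le t
  rw [hX] at h
  unfold mgf at h
  rw [hint] at h
  have e : Real.exp (t * p + t ^ 2 / 8) = Real.exp (t * p) * Real.exp (t ^ 2 / 8) := Real.exp_add _ _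
  have e1 : 1 + p * (Real.exp t - 1) =
      Real.exp (t * p) * (p * Real.exp (t * (1 - p)) + (1 - p) * Real.exp (t * (0 - p))) := by
    rw [mul_sub t 1 p, mul_sub t 0 p, Real.exp_sub, Real.exp_sub]
    field_simp
    simp
    ring
  rw [e1, e]
  gcongr
  refine h.trans (le_of_eq ?_)
  congr 1
  simp
  ring

/-- The Chernoff–Hoeffding estimate for the binomial moment generating function. -/
theorem pow_div_exp_le {p a : ℝ} (h0 : 0 ≤ p) (h1 : p ≤ 1) (M : ℕ) :
    (1 + p * (Real.exp (4 * a) - 1)) ^ M / Real.exp (4 * a * ((p + a) * M)) ≤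
      Real.exp (-(2 * a ^ 2 * M)) := by
  -- The parameter t = 4a minimises t²/8 - ta, with value -2a².
  have h := one_add_mul_exp_sub_one_le h0 h1 (4 * a)
  rw [div_le_iff₀ (Real.exp_pos _), ← Real.exp_add]
  have hn : 0 ≤ 1 + p * (Real.exp (4 * a) - 1) := by
    nlinarith [Real.exp_pos (4 * a)]
  refine (pow_le_pow_left₀ hn h M).trans (le_of_eq ?_)
  rw [← Real.exp_nat_mul]
  congr 1
  ring

end Hoeffding

/-! ### Conditioning a uniform edge order on its set of first edges. -/

section EdgeOrders

open MeasureTheory ProbabilityTheory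

variable {V : Type*} [Finite V] {G : SimpleGraph V}

instance EdgeOrder.finite : Finite (EdgeOrder G) :=
  inferInstanceAs (Finite (Fin (Nat.card G.edgeSet) ≃ G.edgeSet))

/-- The ordering `σ` with the edges permuted by `π`. -/
noncomputable def EdgeOrder.relabel (π : Equiv.Perm G.edgeSet) (σ : EdgeOrder G) : EdgeOrder G :=
  Equiv.trans (σ : Fin (Nat.card G.edgeSet) ≃ G.edgeSet) π

omit [Finite V] in
theorem EdgeOrder.relabel_toFun (π : Equiv.Perm G.edgeSet) (σ : EdgeOrder G)
    (i : Fin (Nat.card G.edgeSet)) : (σ.relabel π).toFun i = π (σ.toFun i) := rfl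

omit [Finite V] in
theorem EdgeOrder.relabel_injective (π : Equiv.Perm G.edgeSet) :
    Function.Injective (EdgeOrder.relabel π) := fun _ _ h =>
  Equiv.ext fun i => π.injective (Equiv.congr_fun h i)

omit [Finite V] in
theorem firstEdges_eq_iff (σ : EdgeOrder G) {t : ℕ} (ht : t ≤ Nat.card G.edgeSet)
    {l : List (Sym2 V)} (hl : l.length = t) :
    σ.firstEdges t = l ↔ ∀ i : Fin t, (σ.toFun (Fin.castLE ht i) : Sym2 V) = l[i] := by
  unfold EdgeOrder.firstEdges
  constructor
  · rintro h i
    subst h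
    simp only [Fin.getElem_fin, List.getElem_take, List.getElem_ofFn]
    rfl
  · intro h
    apply List.ext_getElem
    · rw [List.length_take, List.length_ofFn, hl, min_eq_left ht]
    · intro i h1 h2
      have := h ⟨i, hl ▸ h2⟩
      simp only [Fin.getElem_fin] at this
      rw [← this, List.getElem_take, List.getElem_ofFn]
      rfl

omit [Finite V] in
theorem firstEdges_nodup (σ : EdgeOrder G) (t : ℕ) : (σ.firstEdges t).Nodup := by
  refine List.Nodup.sublist (List.take_sublist _ _) (List.nodup_ofFn.2 ?_)
  exact Subtype.val_injective.comp (Equiv.injective _)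

variable [DecidableEq V]

omit [Finite V] in
theorem exists_perm_of_orderings {F : Finset (Sym2 V)} (hF : ↑F ⊆ G.edgeSet)
    (x : Fin F.card ↪ G.edgeSet) {l : List (Sym2 V)} (hl : l ∈ orderings F) :
    ∃ π : Equiv.Perm G.edgeSet, ∀ (i : Fin F.card) (h : (i : ℕ) < l.length),
      (π (x i) : Sym2 V) = l[(i : ℕ)] := by
  obtain ⟨hn, hlF⟩ := (mem_orderings F l).1 hl
  have hlen : l.length = F.card := by rw [← hlF, List.toFinset_card_of_nodup hn]
  have hmemF : ∀ e ∈ l, e ∈ F := fun e he => by rw [← hlF, List.mem_toFinset]; exact he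
  let y : Fin F.card ↪ G.edgeSet :=
    ⟨fun i => ⟨l[(i : ℕ)]'(by rw [hlen]; exact i.2), hF (by
        exact hmemF _ (List.getElem_mem _))⟩, fun i j hij => by
      simp only [Subtype.mk.injEq] at hij
      exact Fin.ext ((hn.getElem_inj_iff).1 hij)⟩
  obtain ⟨π, hπ⟩ := Equiv.Perm.exists_smul_eq_embedding x y
  refine ⟨π, fun i h => ?_⟩
  have := DFunLike.congr_fun hπ i
  rw [Function.Embedding.smul_apply, Equiv.Perm.smul_def] at this
  rw [this]
  rfl

omit [DecidableEq V] in
theorem card_le_of_subset_edgeSet {F : Finset (Sym2 V)} (hF : ↑F ⊆ G.edgeSet) :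
    F.card ≤ Nat.card G.edgeSet := by
  rw [← Set.ncard_coe_finset]
  exact Set.ncard_le_ncard hF (Set.toFinite _)

/-- All orders in the first fibre agree on the initial positions, so a single permutation of the
edges carries l to l' for all of them, injectively. By symmetry the fibres have equal size. -/
theorem card_fiber_le {F : Finset (Sym2 V)} (hF : ↑F ⊆ G.edgeSet) {l l' : List (Sym2 V)}
    (hl : l ∈ orderings F) (hl' : l' ∈ orderings F) :
    Set.ncard {σ : EdgeOrder G | σ.firstEdges F.card = l} ≤
      Set.ncard {σ : EdgeOrder G | σ.firstEdges F.card = l'} := by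
  have hlen : ∀ l ∈ orderings F, l.length = F.card := fun l hl => by
    obtain ⟨hn, hlF⟩ := (mem_orderings F l).1 hl
    rw [← hlF, List.toFinset_card_of_nodup hn]
  have hc := card_le_of_subset_edgeSet hF
  by_cases hne : Set.Nonempty {σ : EdgeOrder G | σ.firstEdges F.card = l}
  · obtain ⟨σ₀, h₀⟩ := hne
    let σ₁ : Fin (Nat.card G.edgeSet) ≃ G.edgeSet := σ₀
    obtain ⟨π, hπ⟩ := exists_perm_of_orderings hF
      ((Fin.castLEEmb hc).trans σ₁.toEmbedding) hl'
    refine Set.ncard_le_ncard_of_injOn (EdgeOrder.relabel π) (fun σ hσ => ?_)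
      (EdgeOrder.relabel_injective π).injOn (Set.toFinite _)
    rw [Set.mem_ofPred_eq, firstEdges_eq_iff _ hc (hlen l' hl')]
    intro i
    have h1 := (firstEdges_eq_iff σ hc (hlen l hl)).1 hσ i
    have h2 := (firstEdges_eq_iff σ₀ hc (hlen l hl)).1 h₀ i
    have h3 : σ.toFun (Fin.castLE hc i) = σ₀.toFun (Fin.castLE hc i) :=
      Subtype.ext (h1.trans h2.symm)
    rw [EdgeOrder.relabel_toFun, h3]
    exact hπ i (by rw [hlen l' hl']; exact i.2)
  · rw [Set.not_nonempty_iff_eq_empty.1 hne]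
    simp

theorem exists_firstEdges_eq {F : Finset (Sym2 V)} (hF : ↑F ⊆ G.edgeSet) {l : List (Sym2 V)}
    (hl : l ∈ orderings F) : ∃ σ : EdgeOrder G, σ.firstEdges F.card = l := by
  have hc := card_le_of_subset_edgeSet hF
  obtain ⟨hn, hlF⟩ := (mem_orderings F l).1 hl
  have hlen : l.length = F.card := by rw [← hlF, List.toFinset_card_of_nodup hn]
  let σ₁ : Fin (Nat.card G.edgeSet) ≃ G.edgeSet := (Finite.equivFin _).symm
  obtain ⟨π, hπ⟩ := exists_perm_of_orderings hF
    ((Fin.castLEEmb hc).trans σ₁.toEmbedding) hl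
  refine ⟨EdgeOrder.relabel π σ₁, ?_⟩
  rw [firstEdges_eq_iff _ hc hlen]
  exact fun i => hπ i (by rw [hlen]; exact i.2)

omit [Finite V] in
theorem released_eq_iff {F : Finset (Sym2 V)} (σ : EdgeOrder G) (t : ℕ) :
    σ.released t = ↑F ↔ σ.firstEdges t ∈ orderings F := by
  rw [mem_orderings]
  simp only [firstEdges_nodup, true_and]
  unfold EdgeOrder.released
  rw [← Finset.coe_inj, List.coe_toFinset]

/-- Given that `F` is the set of the first edges, all orderings of `F` are equally likely. -/
theorem exists_sum_firstEdges {F : Finset (Sym2 V)} (hF : ↑F ⊆ G.edgeSet)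
    (S : Finset (EdgeOrder G)) (hS : ∀ σ, σ ∈ S ↔ σ.released F.card = ↑F) :
    ∃ c : ℕ, 0 < c ∧ ∀ g : List (Sym2 V) → ℝ,
      ∑ σ ∈ S, g (σ.firstEdges F.card) = c * ∑ l ∈ orderings F, g l := by
  classical
  have hmem : F.toList ∈ orderings F := by
    rw [mem_orderings]; exact ⟨F.nodup_toList, F.toList_toFinset⟩
  refine ⟨Set.ncard {σ : EdgeOrder G | σ.firstEdges F.card = F.toList}, ?_, fun g => ?_⟩
  · rw [Set.ncard_pos (Set.toFinite _)]
    exact exists_firstEdges_eq hF hmem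
  · rw [← Finset.sum_fiberwise_of_maps_to (t := orderings F) (g := fun σ => σ.firstEdges F.card)
      (fun σ hσ => (released_eq_iff σ _).1 ((hS σ).1 hσ)), Finset.mul_sum]
    refine Finset.sum_congr rfl fun l hl => ?_
    rw [Finset.sum_congr rfl (g := fun _ => g l) (fun σ hσ => by rw [(Finset.mem_filter.1 hσ).2]),
      Finset.sum_const, nsmul_eq_mul]
    congr 2
    rw [← Set.ncard_coe_finset]
    have : (↑(S.filter fun σ => σ.firstEdges F.card = l) : Set (EdgeOrder G)) =
        {σ : EdgeOrder G | σ.firstEdges F.card = l} := by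
      ext σ
      simp only [Finset.coe_filter, Set.mem_ofPred_eq, and_iff_right_iff_imp]
      intro h
      rw [hS, released_eq_iff, h]
      exact hl
    rw [this]
    exact le_antisymm (card_fiber_le hF hl hmem) (card_fiber_le hF hmem hl)

omit [Finite V] [DecidableEq V] in
theorem EdgeOrder.measurableSet (s : Set (EdgeOrder G)) : MeasurableSet s :=
  MeasurableSpace.measurableSet_top

omit [Finite V] [DecidableEq V] in
theorem cond_uniformEdgeOrder (F : Set (Sym2 V)) (t : ℕ) :
    cond (uniformEdgeOrder G) {σ | σ.released t = F} =
      uniformOn {σ : EdgeOrder G | σ.released t = F} := by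
  unfold uniformEdgeOrder uniformOn
  rw [cond_cond_eq_cond_inter' (EdgeOrder.measurableSet _) (EdgeOrder.measurableSet _), Set.univ_inter]
  rw [Measure.count_apply_finite _ Set.finite_univ]
  exact ENNReal.natCast_ne_top _

theorem sum_orderings_reverse {ι : Type*} [DecidableEq ι] (E : Finset ι) (g : List ι → ℝ) :
    ∑ l ∈ orderings E, g l.reverse = ∑ l ∈ orderings E, g l := by
  refine Finset.sum_nbij' List.reverse List.reverse ?_ ?_ ?_ ?_ ?_ <;> simp [mem_orderings]

instance EdgeOrder.measurableSingletonClass : MeasurableSingletonClass (EdgeOrder G) := ⟨fun _ => EdgeOrder.measurableSet _⟩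

/-- Markov's inequality. Reversing the list is harmless because reversal permutes the orderings of
F. -/
theorem cond_real_le_of_sum_le {F : Finset (Sym2 V)} (hF : ↑F ⊆ G.edgeSet)
    (W : List (Sym2 V) → ℝ) (hW : ∀ l, 0 ≤ W l) {C K : ℝ} (hK : 0 < K)
    (hC : ∑ l ∈ orderings F, W l ≤ F.card.factorial * C) :
    (cond (uniformEdgeOrder G) {σ | σ.released F.card = ↑F}).real
      {σ | K ≤ W (σ.firstEdges F.card).reverse} ≤ C / K := by
  classical
  have : Fintype (EdgeOrder G) := Fintype.ofFinite _
  rw [cond_uniformEdgeOrder]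
  set S : Finset (EdgeOrder G) := Finset.univ.filter fun σ => σ.released F.card = ↑F with hS
  set A : Finset (EdgeOrder G) :=
    Finset.univ.filter fun σ => K ≤ W (σ.firstEdges F.card).reverse with hA
  have e1 : {σ : EdgeOrder G | σ.released F.card = ↑F} = ↑S := by ext; simp [hS]
  have e2 : {σ : EdgeOrder G | K ≤ W (σ.firstEdges F.card).reverse} = ↑A := by ext; simp [hA]
  rw [e1, e2, measureReal_def, uniformOn_apply_finset, ENNReal.toReal_div, ENNReal.toReal_natCast,
    ENNReal.toReal_natCast]
  obtain ⟨c, hc0, hc⟩ := exists_sum_firstEdges (G := G) hF S (fun σ => by simp [hS])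
  have h1 := hc fun _ => 1
  rw [Finset.sum_const, Finset.sum_const, nsmul_eq_mul, nsmul_eq_mul, mul_one, mul_one,
    card_orderings] at h1
  have h2 := hc fun l => W l.reverse
  rw [sum_orderings_reverse F W] at h2
  have hSpos : (0 : ℝ) < S.card := by rw [h1]; positivity
  have h3 : ((S ∩ A).card : ℝ) * K ≤ ∑ σ ∈ S, W (σ.firstEdges F.card).reverse := by
    calc ((S ∩ A).card : ℝ) * K = ∑ σ ∈ S ∩ A, K := by rw [Finset.sum_const, nsmul_eq_mul]
      _ ≤ ∑ σ ∈ S ∩ A, W (σ.firstEdges F.card).reverse := Finset.sum_le_sum fun σ hσ => by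
          have := (Finset.mem_inter.1 hσ).2
          simpa [hA] using this
      _ ≤ _ := Finset.sum_le_sum_of_subset_of_nonneg Finset.inter_subset_left
          fun σ _ _ => hW _
  rw [div_le_div_iff₀ hSpos hK]
  refine h3.trans ?_
  rw [h2, h1]
  calc (c : ℝ) * ∑ l ∈ orderings F, W l ≤ c * (F.card.factorial * C) := by gcongr
    _ = _ := by ring

theorem isProbabilityMeasure_cond {F : Finset (Sym2 V)} (hF : ↑F ⊆ G.edgeSet) :
    IsProbabilityMeasure (cond (uniformEdgeOrder G) {σ | σ.released F.card = ↑F}) := by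
  rw [cond_uniformEdgeOrder]
  refine isProbabilityMeasure_uniformOn (Set.toFinite _) ?_
  have hmem : F.toList ∈ orderings F := by
    rw [mem_orderings]; exact ⟨F.nodup_toList, F.toList_toFinset⟩
  obtain ⟨σ, hσ⟩ := exists_firstEdges_eq hF hmem
  exact ⟨σ, (released_eq_iff σ _).2 (hσ ▸ hmem)⟩

end EdgeOrders

/-! ### Stability of the Jaccard similarity. -/

section Jaccard

/-- Jaccard similarity is stable under the removal of a small fraction of both sets. -/
theorem jaccard_le_and_ge {V : Type*} [Finite V] {A B A' B' : Set V} (hA : A' ⊆ A) (hB : B' ⊆ B)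
    (hne : A'.Nonempty) {e : ℝ} (he : 0 ≤ e) (hmA : ((A \ A').ncard : ℝ) ≤ e * A.ncard)
    (hmB : ((B \ B').ncard : ℝ) ≤ e * B.ncard) :
    (e < 1 / 2 → jaccard A' B' ≤ jaccard A B / (1 - 2 * e)) ∧
      (1 - e) * jaccard A B - e ≤ jaccard A' B' := by
  have hsum : ((A ∪ B).ncard : ℝ) + (A ∩ B).ncard = A.ncard + B.ncard := by
    exact_mod_cast Set.ncard_union_add_ncard_inter A B
  have hi : ((A ∩ B).ncard : ℝ) ≤ (A' ∩ B').ncard + (A \ A').ncard + (B \ B').ncard := by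
    have h1 : A ∩ B ⊆ (A' ∩ B') ∪ (A \ A') ∪ (B \ B') := by
      rintro x ⟨ha, hb⟩
      by_cases h1 : x ∈ A' <;> by_cases h2 : x ∈ B' <;> simp [*]
    have := (Set.ncard_le_ncard h1 (Set.toFinite _)).trans (Set.ncard_union_le _ _)
    have := this.trans (Nat.add_le_add_right (Set.ncard_union_le _ _) _)
    exact_mod_cast this
  have hu : ((A ∪ B).ncard : ℝ) ≤ (A' ∪ B').ncard + (A \ A').ncard + (B \ B').ncard := by
    have h1 : A ∪ B ⊆ (A' ∪ B') ∪ (A \ A') ∪ (B \ B') := by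
      intro x hx
      rcases hx with hx | hx
      · by_cases h1 : x ∈ A' <;> simp [*]
      · by_cases h1 : x ∈ B' <;> simp [*]
    have := (Set.ncard_le_ncard h1 (Set.toFinite _)).trans (Set.ncard_union_le _ _)
    have := this.trans (Nat.add_le_add_right (Set.ncard_union_le _ _) _)
    exact_mod_cast this
  have hi' : ((A' ∩ B').ncard : ℝ) ≤ (A ∩ B).ncard := by
    exact_mod_cast Set.ncard_le_ncard (Set.inter_subset_inter hA hB) (Set.toFinite _)
  have hu' : ((A' ∪ B').ncard : ℝ) ≤ (A ∪ B).ncard := by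
    exact_mod_cast Set.ncard_le_ncard (Set.union_subset_union hA hB) (Set.toFinite _)
  have hiu : ((A ∩ B).ncard : ℝ) ≤ (A ∪ B).ncard := by
    exact_mod_cast Set.ncard_le_ncard
      (Set.inter_subset_left.trans Set.subset_union_left) (Set.toFinite _)
  have hpos : (0 : ℝ) < (A' ∪ B').ncard := by
    exact_mod_cast (Set.ncard_pos (Set.toFinite _)).2 (hne.mono Set.subset_union_left)
  unfold jaccard
  have hi0 : (0 : ℝ) ≤ (A' ∩ B').ncard := Nat.cast_nonneg _
  have hI0 : (0 : ℝ) ≤ (A ∩ B).ncard := Nat.cast_nonneg _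
  generalize ((A' ∪ B').ncard : ℝ) = U' at *
  generalize ((A ∪ B).ncard : ℝ) = U at *
  generalize ((A' ∩ B').ncard : ℝ) = I' at *
  generalize ((A ∩ B).ncard : ℝ) = I at *
  have hU : 0 < U := by linarith
  -- The total loss is at most e(U + I), hence at most 2eU: the first form gives the lower bound,
  -- the second the factor 1 - 2e.
  have hm : e * (A.ncard : ℝ) + e * B.ncard = e * (U + I) := by rw [hsum]; ring
  constructor
  · intro h2
    have h12 : 0 < 1 - 2 * e := by linarith
    rw [div_div, div_le_div_iff₀ hpos (by positivity)]
    have : U * (1 - 2 * e) ≤ U' := by nlinarith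
    exact mul_le_mul hi' this (by positivity) hI0
  · calc (1 - e) * (I / U) - e = (I - e * (U + I)) / U := by field_simp; ring
      _ ≤ I' / U := by gcongr; linarith
      _ ≤ I' / U' := by gcongr

end Jaccard

/-! ### Missing vertices and their tail bound. -/

section Misses

variable {V : Type*}

open Classical in
theorem lazyAlg_tracks (φ : ℝ) (ends : Sym2 V → V × V)
    (hends : ∀ e : Sym2 V, s((ends e).1, (ends e).2) = e) (l : List (Sym2 V))
    (hl : ∀ e ∈ l, ¬ e.IsDiag) :
    Tracks (lazyAlg φ ⊥ (l.map ends)) (fun a b => s(a, b) ∈ l)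
      (fun x => {w | s(x, w) ∈ recentAt x l.reverse (redBlack φ (l.countP (x ∈ ·))).1}) ∧
    (lazyAlg φ ⊥ (l.map ends)).graph = SimpleGraph.fromEdgeSet {e | e ∈ l} := by
  have h := foldr_tracks φ ends hends l.reverse (by simpa using hl)
  simp only [List.foldr_reverse, List.mem_reverse, List.countP_reverse] at h
  unfold lazyAlg
  rw [List.foldl_map]
  exact ⟨h.1, h.2.2⟩

/-- A neighbour w of u is never missed: w lies in its own 1-ball and is not pending at itself, so
the cover property applies with middle vertex w. -/
theorem Tracks.mem_layer_of_notMem {s : LazyState V} {D : V → V → Prop} {pend : V → Set V}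
    (h : Tracks s D pend) (hD : ∀ x y, s.graph.Adj x y → D x y) {u w : V}
    (hw : w ∈ ball s.graph 2 u) (hw' : w ∉ s.apx2 u) : w ∈ layer s.graph 2 u := by
  refine le_antisymm hw (not_lt.1 fun hlt => hw' ?_)
  have h1 : s.graph.edist u w ≤ 1 := Order.le_of_lt_add_one (by
    refine hlt.trans_le ?_
    norm_num)
  rcases SimpleGraph.edist_le_one_iff_adj_or_eq.1 h1 with h1 | rfl
  · exact h.cover u w w (hD _ _ h1) (h.self_mem w) (h.pend_irrefl w)
  · exact h.self_mem_two u

open Classical in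
/-- A vertex at distance two that is missing from the approximate 2-ball lies on a recent edge. -/
theorem mem_recentAt_of_notMem_apx {φ : ℝ} {ends : Sym2 V → V × V}
    (hends : ∀ e : Sym2 V, s((ends e).1, (ends e).2) = e) {l : List (Sym2 V)}
    (hl : ∀ e ∈ l, ¬ e.IsDiag) {u x w : V} (hux : s(u, x) ∈ l) (hxw : s(x, w) ∈ l)
    (hw : w ∉ (lazyAlg φ ⊥ (l.map ends)).apx2 u) :
    s(x, w) ∈ recentAt x l.reverse (redBlack φ (l.countP (x ∈ ·))).1 := by
  obtain ⟨h, -⟩ := lazyAlg_tracks φ ends hends l hl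
  by_contra hc
  exact hw (h.cover u x w hux (h.mem_one x w hxw) hc)

open MeasureTheory ProbabilityTheory

open Classical in
/-- Conditionally on the set `F` of the first edges, the approximate 2-ball of `u` misses more than a
fraction `φ / (1 + φ) + a` of the 2-ball with exponentially small probability. -/
theorem prob_miss_le [Finite V] {G : SimpleGraph V} {ends : Sym2 V → V × V}
    (hends : ∀ e : Sym2 V, s((ends e).1, (ends e).2) = e) {F : Finset (Sym2 V)}
    (hF : ↑F ⊆ G.edgeSet) {φ a : ℝ} (hφ : 0 ≤ φ) (ha : 0 < a) (u : V) :
    (cond (uniformEdgeOrder G) {σ | σ.released F.card = ↑F}).real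
      {σ | σ.released F.card = ↑F ∧
        (φ / (1 + φ) + a) * ((ball (SimpleGraph.fromEdgeSet ↑F) 2 u).ncard : ℝ) <
          ((ball (SimpleGraph.fromEdgeSet ↑F) 2 u \ σ.apxBall φ ends F.card u).ncard : ℝ)} ≤
      Real.exp (-(2 * a ^ 2 * ((layer (SimpleGraph.fromEdgeSet ↑F) 2 u).ncard : ℝ))) := by
  have : Fintype V := Fintype.ofFinite V
  set H : SimpleGraph V := SimpleGraph.fromEdgeSet ↑F with hH
  have hdiag : ∀ e ∈ F, ¬ e.IsDiag := fun e he => SimpleGraph.not_isDiag_of_mem_edgeSet G (hF he)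
  have hadj : ∀ x y, H.Adj x y ↔ s(x, y) ∈ F := by
    intro x y
    rw [hH, SimpleGraph.fromEdgeSet_adj, Finset.mem_coe, and_iff_left_iff_imp]
    intro h
    simpa using hdiag _ h
  set p := φ / (1 + φ) with hp
  have hp0 : 0 ≤ p := by positivity
  have hp1 : p ≤ 1 := by rw [hp, div_le_one (by linarith)]; linarith
  let N : Finset V := Finset.univ.filter fun x => H.Adj u x
  let L : Finset V := Finset.univ.filter fun w => w ∈ layer H 2 u
  have hLmem : ∀ w ∈ L, w ∈ layer H 2 u := fun w hw => (Finset.mem_filter.1 hw).2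
  have hLN : ∀ w, w ∈ L → w ∉ N := by
    intro w hw hN
    have h1 := hLmem w hw
    have h2 := SimpleGraph.edist_eq_one_iff_adj.2 (Finset.mem_filter.1 hN).2
    rw [layer, Set.mem_ofPred_eq, h2] at h1
    norm_num at h1
  -- One middle vertex per w is enough, and makes the marked edge determine w. Outside `L` the value
  -- u is arbitrary.
  have hmid : ∀ w, ∃ x, w ∈ L → H.Adj u x ∧ H.Adj x w := by
    intro w
    by_cases hw : w ∈ L
    · obtain ⟨-, -, x, hx⟩ := SimpleGraph.edist_eq_two_iff.1 (hLmem w hw)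
      rw [SimpleGraph.mem_commonNeighbors] at hx
      exact ⟨x, fun _ => ⟨hx.1, hx.2.symm⟩⟩
    · exact ⟨u, fun h => absurd h hw⟩
  choose c hc using hmid
  have hcN : ∀ w ∈ L, c w ∈ N := fun w hw => by simp [N, (hc w hw).1]
  let P : Sym2 V → Prop := fun e => ∃ w ∈ L, s(c w, w) = e
  let T : Sym2 V → Finset V := fun e => N.filter fun x => x ∈ e
  have hTmem : ∀ e x, x ∈ T e ↔ x ∈ N ∧ x ∈ e := fun e x => Finset.mem_filter
  have hTN : ∀ e, T e ⊆ N := fun e => Finset.filter_subset _ _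
  have hT2 : ∀ e, (T e).card ≤ 2 := by
    intro e
    induction e with | _ x y =>
    refine (Finset.card_le_card (t := {x, y}) fun z hz => ?_).trans Finset.card_le_two
    have := ((hTmem _ z).1 hz).2
    simpa using this
  -- The far endpoint of a marked edge is at distance two from u, so it is not the centre of a
  -- tracked star.
  have hP1 : ∀ e, P e → (T e).card = 1 := by
    rintro _ ⟨w, hw, rfl⟩
    rw [Finset.card_eq_one]
    refine ⟨c w, Finset.ext fun z => ?_⟩
    rw [hTmem, Sym2.mem_iff, Finset.mem_singleton]
    constructor
    · rintro ⟨hz, rfl | rfl⟩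
      · rfl
      · exact absurd hz (hLN _ hw)
    · rintro rfl
      exact ⟨hcN w hw, Or.inl rfl⟩
  -- Red degrees depend on degrees only, so given F they do not depend on the order.
  let r : V → ℕ := fun x => (redBlack φ (starCard T F x)).1
  have hr : ∀ x, r x ≤ starCard T F x := fun x => by
    have := redBlack_add φ (starCard T F x)
    change (redBlack φ (starCard T F x)).1 ≤ _
    omega
  set z : ℝ := Real.exp (4 * a) - 1 with hz
  have hz0 : 0 ≤ z := by
    have := Real.one_le_exp (x := 4 * a) (by positivity)
    linarith
  have hz1 : 1 + z = Real.exp (4 * a) := by rw [hz]; ring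
  -- Bounds the total exponent of the potential: one for each marked edge and one extra for each
  -- star.
  set M : ℕ := L.card + N.card with hM
  have hmark : ∑ x ∈ N, markCard T P F x ≤ L.card := by
    have h1 : ∑ x ∈ N, markCard T P F x = (F.filter P).card := by
      have : ∀ x ∈ N, markCard T P F x = ((F.filter P).filter fun e => x ∈ T e).card := by
        intro x _
        unfold markCard
        rw [Finset.filter_filter]
        simp only [and_comm]
      rw [Finset.sum_congr rfl this, Finset.card_eq_sum_ones]
      simp only [Finset.card_filter _ (F.filter P)]
      rw [Finset.sum_comm]
      refine Finset.sum_congr rfl fun e he => ?_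
      rw [← Finset.card_filter, ← hP1 e (Finset.mem_filter.1 he).2]
      congr 1
      ext x
      simp only [Finset.mem_filter, hTmem]
      tauto
    rw [h1]
    refine (Finset.card_le_card (t := L.image fun w => s(c w, w)) fun e he => ?_).trans
      Finset.card_image_le
    obtain ⟨w, hw, rfl⟩ := (Finset.mem_filter.1 he).2
    exact Finset.mem_image_of_mem _ hw
  have hpot : ∏ x ∈ N, starPot z (markCard T P F x) (starCard T F x) (r x) ≤ (1 + p * z) ^ M := by
    have h1 : (1 : ℝ) ≤ 1 + p * z := by
      have := mul_nonneg hp0 hz0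
      linarith
    calc ∏ x ∈ N, starPot z (markCard T P F x) (starCard T F x) (r x)
        ≤ ∏ x ∈ N, (1 + p * z) ^ (markCard T P F x + 1) := by
          refine Finset.prod_le_prod (fun x _ => (starPot_pos hz0 _ _ _).le) fun x _ => ?_
          unfold starPot
          have : (r x : ℝ) / starCard T F x ≤ p :=
            div_le_of_le_mul₀ (Nat.cast_nonneg _) hp0 (red_le_mul hφ _)
          gcongr
      _ = (1 + p * z) ^ ∑ x ∈ N, (markCard T P F x + 1) := Finset.prod_pow_eq_pow_sum _ _ _
      _ ≤ (1 + p * z) ^ M := by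
          refine pow_le_pow_right₀ h1 ?_
          rw [Finset.sum_add_distrib, Finset.sum_const, smul_eq_mul, mul_one]
          omega
  have hweight := sum_slotWeight_le T P N hTN hT2 hP1 hz0 F r fun x _ => hr x
  have hW0 : ∀ l, 0 ≤ slotWeight T P z l r := fun l =>
    le_trans (by positivity) (pow_recentMarked_le T P N hTmem hz0 l r)
  have hsum : ∑ l ∈ orderings F, slotWeight T P z l r ≤
      F.card.factorial * (1 + p * z) ^ M :=
    hweight.trans (mul_le_mul_of_nonneg_left hpot (Nat.cast_nonneg _))
  have hprob := cond_real_le_of_sum_le hF (fun l => slotWeight T P z l r) hW0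
    (Real.exp_pos (4 * a * ((p + a) * M))) hsum
  have := isProbabilityMeasure_cond hF
  refine (measureReal_mono ?_).trans (hprob.trans ((pow_div_exp_le hp0 hp1 M).trans ?_))
  · rintro σ ⟨hσ, hmiss⟩
    rw [released_eq_iff] at hσ
    obtain ⟨hn, hlF⟩ := (mem_orderings F _).1 hσ
    change (_ : ℝ) < ((ball H 2 u \ (lazyAlg φ ⊥ ((σ.firstEdges F.card).map ends)).apx2 u).ncard : ℝ)
      at hmiss
    rw [Set.mem_ofPred_eq]
    generalize σ.firstEdges F.card = l at *
    have hlmem : ∀ e, e ∈ l ↔ e ∈ F := fun e => by rw [← hlF, List.mem_toFinset]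
    have hld : ∀ e ∈ l, ¬ e.IsDiag := fun e he => hdiag e ((hlmem e).1 he)
    refine le_trans ?_ (pow_recentMarked_le T P N hTmem hz0 _ _)
    rw [hz1, ← Real.exp_nat_mul, mul_comm _ (4 * a)]
    refine Real.exp_le_exp.2 (mul_le_mul_of_nonneg_left ?_ (by positivity))
    have hcount : ∀ x ∈ N, l.countP (x ∈ ·) = starCard T F x := by
      intro x hx
      unfold starCard
      rw [List.countP_eq_length_filter, ← List.toFinset_card_of_nodup (hn.filter _)]
      congr 1
      ext e
      simp [hlmem, hTmem, hx]
    obtain ⟨htr, hgr⟩ := lazyAlg_tracks φ ends hends l hld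
    have hgr' : (lazyAlg φ ⊥ (l.map ends)).graph = H := by
      rw [hgr, hH]
      congr 1
      ext e
      simp [hlmem]
    have hms : (ball H 2 u \ (lazyAlg φ ⊥ (l.map ends)).apx2 u).ncard ≤
        (recentMarked T P l.reverse r).ncard := by
      have hL : ∀ w ∈ ball H 2 u \ (lazyAlg φ ⊥ (l.map ends)).apx2 u, w ∈ L := by
        rintro w ⟨hw, hw'⟩
        rw [← hgr'] at hw
        have := htr.mem_layer_of_notMem (fun x y hxy => by
          rw [hgr', hadj] at hxy
          exact (hlmem _).2 hxy) hw hw'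
        rw [hgr'] at this
        simp [L, this]
      refine Set.ncard_le_ncard_of_injOn (fun w => s(c w, w)) ?_ ?_ (recentMarked_finite _ _ _ _)
      · intro w hw
        have hwL := hL w hw
        refine ⟨⟨w, hwL, rfl⟩, c w, (hTmem _ _).2 ⟨hcN w hwL, Sym2.mem_mk_left _ _⟩, ?_⟩
        have := mem_recentAt_of_notMem_apx hends hld
          ((hlmem _).2 ((hadj _ _).1 (hc w hwL).1)) ((hlmem _).2 ((hadj _ _).1 (hc w hwL).2)) hw.2
        rwa [hcount _ (hcN w hwL)] at this
      · intro w hw w' hw' h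
        simp only [Sym2.eq_iff] at h
        rcases h with h | h
        · exact h.2
        · exact absurd (h.2 ▸ hcN w' (hL w' hw')) (hLN w (hL w hw))
    -- This is where the extra exponents are paid for: the neighbours of u also count in the 2-ball
    -- against which the loss is measured.
    have hball : M ≤ (ball H 2 u).ncard := by
      have hdisj : Disjoint L N := Finset.disjoint_left.2 hLN
      rw [hM, ← Finset.card_union_of_disjoint hdisj, ← Set.ncard_coe_finset]
      refine Set.ncard_le_ncard (fun w hw => ?_) (Set.toFinite _)
      rw [Finset.mem_coe, Finset.mem_union] at hw
      rcases hw with hw | hw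
      · exact (hLmem w hw).le
      · refine (SimpleGraph.edist_eq_one_iff_adj.2 (Finset.mem_filter.1 hw).2).le.trans ?_
        norm_num
    calc (p + a) * (M : ℝ) ≤ (p + a) * ((ball H 2 u).ncard : ℝ) := by gcongr
      _ ≤ _ := hmiss.le
      _ ≤ _ := by exact_mod_cast hms
  · have hLM : ((layer H 2 u).ncard : ℝ) ≤ M := by
      have : (layer H 2 u).ncard = L.card := by
        rw [← Set.ncard_coe_finset]; congr 1; ext; simp [L]
      rw [this, hM]
      push_cast
      linarith [Nat.cast_nonneg (α := ℝ) N.card]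
    refine Real.exp_le_exp.2 (neg_le_neg ?_)
    gcongr

end Misses

/-! ### The union bound over the two vertices. -/

theorem corollary3p4 {V : Type*} [Finite V] (G : SimpleGraph V)
    (ends : Sym2 V → V × V) (hends : ∀ e : Sym2 V, s((ends e).1, (ends e).2) = e)
    (ε φ α ε' : ℝ) (hε₀ : 0 < ε) (hε₁ : ε < 1) (hφ : φ = ε / (1 - ε)) (hα : 0 < α)
    (hε' : ε' = (φ + α) / (1 + φ))
    (t : ℕ) (F : Set (Sym2 V)) (hF : F ⊆ G.edgeSet) (ht : F.ncard = t)
    (H : SimpleGraph V) (hH : H = SimpleGraph.fromEdgeSet F) (u v : V) :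
    1 - Real.exp (-(2 * α ^ 2 * ((layer H 2 u).ncard : ℝ) / (1 + φ) ^ 2))
        - Real.exp (-(2 * α ^ 2 * ((layer H 2 v).ncard : ℝ) / (1 + φ) ^ 2)) ≤
      (ProbabilityTheory.cond (uniformEdgeOrder G) {σ | σ.released t = F}).real
        {σ | (ε' < 1 / 2 →
                jaccard (σ.apxBall φ ends t u) (σ.apxBall φ ends t v) ≤
                  jaccard (ball H 2 u) (ball H 2 v) / (1 - 2 * ε')) ∧
              (1 - ε') * jaccard (ball H 2 u) (ball H 2 v) - ε' ≤
                jaccard (σ.apxBall φ ends t u) (σ.apxBall φ ends t v)} := by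
  classical
  obtain ⟨F, rfl⟩ : ∃ F' : Finset (Sym2 V), F = ↑F' :=
    ⟨(Set.toFinite F).toFinset, by simp⟩
  rw [Set.ncard_coe_finset] at ht
  subst ht hH
  have hφ0 : 0 ≤ φ := by rw [hφ]; exact div_nonneg hε₀.le (by linarith)
  have ha : 0 < α / (1 + φ) := by positivity
  have hεa : φ / (1 + φ) + α / (1 + φ) = ε' := by rw [hε']; ring
  have hε0 : 0 ≤ ε' := by rw [← hεa]; positivity
  have hu := prob_miss_le hends hF hφ0 ha u
  have hv := prob_miss_le hends hF hφ0 ha v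
  rw [hεa] at hu hv
  have hexp : ∀ n : ℝ, 2 * (α / (1 + φ)) ^ 2 * n = 2 * α ^ 2 * n / (1 + φ) ^ 2 := by
    intro n; rw [div_pow]; ring
  rw [hexp] at hu hv
  have := isProbabilityMeasure_cond hF
  set μ := ProbabilityTheory.cond (uniformEdgeOrder G) {σ | σ.released F.card = ↑F} with hμ
  set H := SimpleGraph.fromEdgeSet (F : Set (Sym2 V)) with hH
  have hR : μ.real {σ | σ.released F.card = ↑F}ᶜ = 0 := by
    rw [MeasureTheory.measureReal_def, hμ,
      ProbabilityTheory.cond_apply (EdgeOrder.measurableSet _), Set.inter_compl_self]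
    simp
  set A := {σ : EdgeOrder G | (ε' < 1 / 2 →
      jaccard (σ.apxBall φ ends F.card u) (σ.apxBall φ ends F.card v) ≤
        jaccard (ball H 2 u) (ball H 2 v) / (1 - 2 * ε')) ∧
      (1 - ε') * jaccard (ball H 2 u) (ball H 2 v) - ε' ≤
        jaccard (σ.apxBall φ ends F.card u) (σ.apxBall φ ends F.card v)} with hA
  let B : V → Set (EdgeOrder G) := fun u => {σ | σ.released F.card = ↑F ∧
    ε' * ((ball H 2 u).ncard : ℝ) < ((ball H 2 u \ σ.apxBall φ ends F.card u).ncard : ℝ)}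
  -- Orders whose first edges do not form F have conditional measure zero. Among the others, the two
  -- bad events are the only way to fail.
  have hcover : (Set.univ : Set (EdgeOrder G)) ⊆
      A ∪ B u ∪ B v ∪ {σ | σ.released F.card = ↑F}ᶜ := by
    intro σ _
    by_cases hσ : σ.released F.card = ↑F
    · by_cases hbu : σ ∈ B u
      · exact Or.inl (Or.inl (Or.inr hbu))
      by_cases hbv : σ ∈ B v
      · exact Or.inl (Or.inr hbv)
      refine Or.inl (Or.inl (Or.inl ?_))
      have hbu' := not_lt.1 fun h => hbu ⟨hσ, h⟩
      have hbv' := not_lt.1 fun h => hbv ⟨hσ, h⟩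
      have hmem : ∀ e, e ∈ σ.firstEdges F.card ↔ e ∈ F := fun e => by
        rw [← Finset.mem_coe, ← hσ]; rfl
      obtain ⟨htr, hgr⟩ := lazyAlg_tracks φ ends hends (σ.firstEdges F.card)
        fun e he => SimpleGraph.not_isDiag_of_mem_edgeSet G (hF ((hmem e).1 he))
      have hgr' : (lazyAlg φ ⊥ ((σ.firstEdges F.card).map ends)).graph = H := by
        rw [hgr, hH]
        congr 1
      have hsub := htr.subset_two
      rw [hgr'] at hsub
      exact jaccard_le_and_ge (hsub u) (hsub v) ⟨u, htr.self_mem_two u⟩ hε0 hbu' hbv'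
    · exact Or.inr hσ
  have htot : 1 ≤ μ.real A + μ.real (B u) + μ.real (B v) + 0 := by
    rw [← hR, ← MeasureTheory.probReal_univ (μ := μ)]
    refine (MeasureTheory.measureReal_mono hcover).trans ?_
    refine (MeasureTheory.measureReal_union_le _ _).trans (add_le_add_left ?_ _)
    refine (MeasureTheory.measureReal_union_le _ _).trans (add_le_add_left ?_ _)
    exact MeasureTheory.measureReal_union_le _ _
  have hu' : μ.real (B u) ≤ _ := hu
  have hv' : μ.real (B v) ≤ _ := hv
  linarith
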